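/- Let $d\ge 1$ be an integer and let $1<p<2$. There is a constant $c_{p,d}\in(0,\infty)$, depending only on $p$ and $d$, such that the following holds. Let $(\varepsilon_{\mathbf u})_{\mathbf u\in\mathbb Z^d}$ be an i.i.d. family of real random variables on a probability space, let $f\colon\mathbb R^{\mathbb Z^d}\to\mathbb R$ be measurable (for the product topology), and let $X_{\mathbf i}=f\big((\varepsilon_{\mathbf i-\mathbf j})_{\mathbf j\in\mathbb Z^d}\big)$ for $\mathbf i\in\mathbb Z^d$. Suppose that the field is centered, that is, $X_{\mathbf i}$ is integrable and $\mathbb E[X_{\mathbf i}]=0$ for every $\mathbf i$. Then $$\Big\|\sup_{\mathbf n\in\mathbb N^d}\frac{1}{\sqrt{|\mathbf n|\,LL(|\mathbf n|)}}\Big|\sum_{\mathbf 1\preccurlyeq\mathbf i\preccurlyeq\mathbf n}X_{\mathbf i}\Big|\Big\|_p\le c_{p,d}\sum_{j\ge 0}(j+1)^{d/2}\,\|X_{\mathbf 0,j}\|_{2,d-1},$$ as an inequality in $[0,\infty]$. Here $\mathbb N=\{1,2,\dots\}$, $\preccurlyeq$ is the coordinatewise order, $\mathbf 0=(0,\dots,0)$,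 $\mathbf 1=(1,\dots,1)$, $|\mathbf n|=\prod_{q=1}^d n_q$, $L(x)=\max\{\ln x,1\}$ for $x>0$ and $LL=L\circ L$; with $\|\mathbf u\|_\infty=\max_{1\le q\le d}|u_q|$, $$X_{\mathbf 0,0}=\mathbb E[X_{\mathbf 0}\mid\sigma\{\varepsilon_{\mathbf 0}\}],\qquad X_{\mathbf 0,j}=\mathbb E[X_{\mathbf 0}\mid\sigma\{\varepsilon_{\mathbf u}:\|\mathbf u\|_\infty\le j\}]-\mathbb E[X_{\mathbf 0}\mid\sigma\{\varepsilon_{\mathbf u}:\|\mathbf u\|_\infty\le j-1\}]\quad(j\ge 1);$$ and, for a real random variable $Y$ and $r\ge0$, with $\varphi_{2,r}(x)=x^2(1+\log(1+x))^r$ for $x\ge 0$, $$\|Y\|_{2,r}=\inf\{\lambda>0:\ \mathbb E[\varphi_{2,r}(|Y|/\lambda)]\le 1\}\in[0,\infty],\qquad \inf\emptyset=\infty.$$ -/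

import Mathlib

open MeasureTheory ProbabilityTheory
open scoped ENNReal

namespace RandomFieldLIL

/-- `L x = max (ln x) 1`. -/
noncomputable def L (x : ℝ) : ℝ := max (Real.log x) 1

/-- `LL = L ∘ L`. -/
noncomputable def LL (x : ℝ) : ℝ := L (L x)

/-- The Young function `φ_{p,r}(x) = x ^ p * (1 + log (1 + x)) ^ r`, used for `x ≥ 0`. -/
noncomputable def phi (p r x : ℝ) : ℝ := x ^ p * (1 + Real.log (1 + x)) ^ r

/-- The Luxemburg norm `inf {l > 0 | E[φ_{p,r}(|Y| / l)] ≤ 1}`, with value `∞` when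
no such `l` exists, that is, when `Y` is outside the Orlicz space. -/
noncomputable def orliczNorm {Ω : Type*} [MeasurableSpace Ω] (μ : Measure Ω) (p r : ℝ)
    (Y : Ω → ℝ) : ℝ≥0∞ :=
  ⨅ (l : ℝ) (_ : 0 < l) (_ : ∫⁻ ω, ENNReal.ofReal (phi p r (|Y ω| / l)) ∂μ ≤ 1),
    ENNReal.ofReal l

/-- The σ-algebra generated by the `ε u` with `‖u‖_∞ ≤ j`
(the norm of `Fin d → ℤ` is the maximum norm). -/
abbrev sigmaBall {Ω : Type*} {d : ℕ} (ε : (Fin d → ℤ) → Ω → ℝ) (j : ℕ) : MeasurableSpace Ω :=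
  ⨆ u : {u : Fin d → ℤ // ‖u‖ ≤ (j : ℝ)}, MeasurableSpace.comap (ε u) inferInstance

/-- The increments of the successive conditional expectations of `Y`
with respect to `sigmaBall ε j`. -/
noncomputable def increment {Ω : Type*} [MeasurableSpace Ω] (μ : Measure Ω) {d : ℕ}
    (ε : (Fin d → ℤ) → Ω → ℝ) (Y : Ω → ℝ) : ℕ → Ω → ℝ
  | 0 => μ[Y | sigmaBall ε 0]
  | j + 1 => μ[Y | sigmaBall ε (j + 1)] - μ[Y | sigmaBall ε j]

/-- The sum of the field `X` over the rectangle of all `i` with `1 ≤ i ≤ n` coordinatewise. -/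
noncomputable def partialSum {Ω : Type*} {d : ℕ} (X : (Fin d → ℤ) → Ω → ℝ) (n : Fin d → ℕ+) (ω : Ω) : ℝ :=
  ∑ i ∈ Finset.Icc (1 : Fin d → ℤ) (fun q => ((n q : ℕ) : ℤ)), X i ω

/-- `|n| = n_1 * ... * n_d`. -/
noncomputable def vol {d : ℕ} (n : Fin d → ℕ+) : ℝ := ∏ q, ((n q : ℕ) : ℝ)

/-- The maximal function `sup_n |S_n| / sqrt (|n| LL(|n|))`, with values in `[0, ∞]`. -/
noncomputable def maximalFunction {Ω : Type*} {d : ℕ} (X : (Fin d → ℤ) → Ω → ℝ) (ω : Ω) :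
    ℝ≥0∞ :=
  ⨆ n : Fin d → ℕ+, ENNReal.ofReal (|partialSum X n ω| / Real.sqrt (vol n * LL (vol n)))

end RandomFieldLIL

/-! The inequality is proved for i.i.d. fields first; the general case is a superposition of i.i.d.
fields.

For an i.i.d. centered field `Y` of Orlicz norm one, cover the boxes by dyadic blocks `k`, put `s =
∑ k q`, normalize by `psi s = √(2^s wt s)` and truncate at `lev s = √(2^s / wt s)`. The truncated,
recentered sums have exponential moments at scale `1 / lev s`. Exponentials of box sums are
submartingales in each side length, so Doob's inequality applied to one coordinate after another
(Cairoli's argument, `integral_sup'_exp_boxSum_sq_le`) controls the maximum over a block at the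
price `4 ^ d`. Hence the excess of the normalized maximum over a fixed constant has `p`-th moment
`O((s+1)^(-(d+1)))` (`lintegral_iSup_excess_le`), which is summable because at most `(s+1)^(d-1)`
blocks share the same `s`.

The discarded tails are estimated by a Rosenthal-type inequality (`lintegral_sum_rpow_le`). Only
blocks with `lev s < |Y|` contribute; as the levels grow geometrically, such `s` are `O(1 + log (1 +
|Y|))`, and counting blocks yields exactly `|Y|^2 (1 + log (1 + |Y|))^(d-1)`
(`exists_tsum_lev_mul_tail_le`). The sums involve `lev s ^ (2 - p)`, which is where `p < 2` is
needed.

In general, the field is the almost sure sum of its martingale increments over growing balls. The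
`j`-th increment field depends on balls of radius `j`, so it is i.i.d. along each residue class
modulo `K = 2j+1`. A class `a` enters the maximal function with weight `∏ 1/√(1 + a q)`
(`maximalFunction_le_sum_boxMax`); these weights add up to at most `(2√K)^d`, the origin of
`(j+1)^(d/2)`. Minkowski's inequality sums over `j`. -/

namespace RandomFieldLIL

set_option linter.unusedSectionVars false

/-! ### Dyadic weights, truncation levels and counting of blocks -/

/-- The logarithmic weight `1 + log (1 + s)`, comparable to `LL (2 ^ s)`. -/
noncomputable def wt (s : ℕ) : ℝ := 1 + Real.log (1 + s)

/-- The truncation level `√(2 ^ s / wt s)`. -/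
noncomputable def lev (s : ℕ) : ℝ := Real.sqrt (2 ^ s / wt s)

lemma one_le_wt (s : ℕ) : 1 ≤ wt s := by
  have : 0 ≤ Real.log (1 + s) := Real.log_nonneg (by linarith [(Nat.cast_nonneg s : (0 : ℝ) ≤ s)])
  unfold wt; linarith

lemma wt_pos (s : ℕ) : 0 < wt s := one_pos.trans_le (one_le_wt s)

lemma lev_pos (s : ℕ) : 0 < lev s := Real.sqrt_pos.2 (div_pos (by positivity) (wt_pos s))

lemma exp_wt (s : ℕ) : Real.exp (wt s) = Real.exp 1 * (1 + s) := by
  rw [wt, Real.exp_add, Real.exp_log (by positivity)]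

lemma wt_succ_le (s : ℕ) : wt (s + 1) ≤ 1.7 * wt s := by
  have h1 : Real.log (1 + (s + 1 : ℕ)) ≤ Real.log 2 + Real.log (1 + s) := by
    rw [← Real.log_mul (by norm_num) (by positivity)]
    apply Real.log_le_log (by positivity)
    push_cast; linarith [(Nat.cast_nonneg s : (0 : ℝ) ≤ s)]
  have := Real.log_two_lt_d9
  have h3 := one_le_wt s
  unfold wt at *
  linarith

/-- The squared ratio of consecutive levels is `2 * wt s / wt (s + 1) ≥ 2 / 1.7`, which exceeds `(20
/ 19) ^ 2`. This geometric growth is what all sums over levels rely on. -/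
lemma lev_le_succ (s : ℕ) : lev s ≤ 19 / 20 * lev (s + 1) := by
  unfold lev
  have h : (19 / 20 : ℝ) = Real.sqrt ((19 / 20) ^ 2) := by rw [Real.sqrt_sq (by norm_num)]
  rw [h, ← Real.sqrt_mul (by positivity)]
  apply Real.sqrt_le_sqrt
  rw [div_le_iff₀ (wt_pos s)]
  have h1 := wt_succ_le s
  have h2 := wt_pos (s + 1)
  have h3 := wt_pos s
  have h4 : (0 : ℝ) < 2 ^ s := by positivity
  rw [mul_div_assoc', div_mul_eq_mul_div, le_div_iff₀ h2, pow_succ (2 : ℝ) s]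
  nlinarith [mul_le_mul_of_nonneg_left h1 h4.le, mul_pos h4 h3]

lemma lev_zero : lev 0 = 1 := by simp [lev, wt]

lemma one_le_lev_mul (s : ℕ) : 1 ≤ (19 / 20 : ℝ) ^ s * lev s := by
  induction s with
  | zero => simp [lev_zero]
  | succ s ih =>
    refine ih.trans ?_
    rw [pow_succ, mul_assoc]
    exact mul_le_mul_of_nonneg_left (lev_le_succ s) (by positivity)

/-- Geometric growth means that only logarithmically many levels lie below `y`. The factor 20 comes
from `log (19 / 20) ≤ -1 / 20`. -/
lemma add_one_le_of_lev_lt {s : ℕ} {y : ℝ} (h : lev s < y) :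
    (s : ℝ) + 1 ≤ 20 * (1 + Real.log (1 + y)) := by
  have hy : 0 < y := (lev_pos s).trans h
  have h1 : 1 ≤ (19 / 20 : ℝ) ^ s * (1 + y) :=
    (one_le_lev_mul s).trans (mul_le_mul_of_nonneg_left (by linarith) (by positivity))
  have h2 := Real.log_nonneg h1
  rw [Real.log_mul (by positivity) (by positivity), Real.log_pow] at h2
  have h3 : Real.log (19 / 20) ≤ 19 / 20 - 1 := Real.log_le_sub_one_of_pos (by norm_num)
  have h4 : (s : ℝ) * Real.log (19 / 20) ≤ s * (19 / 20 - 1) :=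
    mul_le_mul_of_nonneg_left h3 (Nat.cast_nonneg s)
  linarith

lemma wt_le_LL {s : ℕ} {x : ℝ} (hx : 2 ^ s ≤ x) : wt s ≤ 4 * LL x := by
  have hx0 : 0 < x := lt_of_lt_of_le (by positivity) hx
  have h1 : (s : ℝ) * Real.log 2 ≤ Real.log x := by
    rw [← Real.log_pow]; exact Real.log_le_log (by positivity) hx
  have h2 := Real.log_two_gt_d9
  have h3 : (1 + s : ℝ) / 4 ≤ L x := by
    unfold L
    rcases Nat.eq_zero_or_pos s with rfl | hs
    · exact le_max_of_le_right (by norm_num)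
    · have : (1 : ℝ) ≤ s := by exact_mod_cast hs
      apply le_max_of_le_left
      nlinarith
  have h4 : Real.log ((1 + s : ℝ) / 4) ≤ LL x := by
    unfold LL; nth_rw 1 [L]
    exact le_max_of_le_left (Real.log_le_log (by positivity) h3)
  have h5 : 1 ≤ LL x := by unfold LL; nth_rw 1 [L]; exact le_max_right _ _
  rw [Real.log_div (by positivity) (by norm_num)] at h4
  have h6 : Real.log 4 = 2 * Real.log 2 := by
    rw [show (4 : ℝ) = 2 ^ 2 by norm_num, Real.log_pow]; norm_num
  have := Real.log_two_lt_d9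
  unfold wt
  linarith

lemma L_mono {x y : ℝ} (hx : 0 < x) (h : x ≤ y) : L x ≤ L y :=
  max_le_max_right _ (Real.log_le_log hx h)

lemma one_le_L (x : ℝ) : 1 ≤ L x := le_max_right _ _

lemma one_le_LL (x : ℝ) : 1 ≤ LL x := one_le_L _

lemma LL_mono {x y : ℝ} (hx : 0 < x) (h : x ≤ y) : LL x ≤ LL y :=
  L_mono (one_pos.trans_le (one_le_L x)) (L_mono hx h)

/-- A geometrically growing sum is comparable to its last term, and every term present is below `y ^
α`. -/
lemma tsum_lev_lt_le {α : ℝ} (hα : 0 < α) (y : ℝ) :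
    ∑' s, (if lev s < y then ENNReal.ofReal (lev s ^ α) else 0) ≤
      ENNReal.ofReal (1 / (1 - (19 / 20 : ℝ) ^ α)) * ENNReal.ofReal (y ^ α) := by
  set r : ℝ := (19 / 20 : ℝ) ^ α with hr
  have hr1 : r < 1 := Real.rpow_lt_one (by norm_num) (by norm_num) hα
  have hr0 : 0 < r := Real.rpow_pos_of_pos (by norm_num) _
  have hc : 0 < 1 / (1 - r) := one_div_pos.2 (by linarith)
  have hstep : ∀ s, lev s ^ α ≤ r * lev (s + 1) ^ α := fun s => by
    rw [hr, ← Real.mul_rpow (by norm_num) (lev_pos _).le]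
    exact Real.rpow_le_rpow (lev_pos s).le (lev_le_succ s) hα.le
  have hsum : ∀ n, ∑ s ∈ Finset.range (n + 1), lev s ^ α ≤ 1 / (1 - r) * lev n ^ α := by
    intro n
    induction n with
    | zero =>
      simp only [zero_add, Finset.range_one, Finset.sum_singleton, lev_zero, Real.one_rpow, mul_one]
      rw [le_div_iff₀ (by linarith)]; linarith
    | succ n ih =>
      rw [Finset.sum_range_succ]
      have h1 := mul_le_mul_of_nonneg_left (hstep n) hc.le
      have h2 : 1 / (1 - r) * (r * lev (n + 1) ^ α) + lev (n + 1) ^ α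
          = 1 / (1 - r) * lev (n + 1) ^ α := by
        field_simp [(by linarith : (1 - r) ≠ 0)]; ring
      linarith
  rw [ENNReal.tsum_eq_iSup_nat]
  refine iSup_le fun n => ?_
  induction n with
  | zero => simp
  | succ n ih =>
    by_cases h : lev n < y
    · calc _ ≤ ∑ s ∈ Finset.range (n + 1), ENNReal.ofReal (lev s ^ α) :=
            Finset.sum_le_sum fun s _ => by split_ifs <;> simp
        _ = ENNReal.ofReal (∑ s ∈ Finset.range (n + 1), lev s ^ α) :=
            (ENNReal.ofReal_sum_of_nonneg fun s _ => (Real.rpow_pos_of_pos (lev_pos s) _).le).symm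
        _ ≤ ENNReal.ofReal (1 / (1 - r) * y ^ α) := by
            apply ENNReal.ofReal_le_ofReal
            refine (hsum n).trans (mul_le_mul_of_nonneg_left ?_ hc.le)
            exact Real.rpow_le_rpow (lev_pos n).le h.le hα.le
        _ = _ := ENNReal.ofReal_mul hc.le
    · rw [Finset.sum_range_succ, if_neg h, add_zero]; exact ih

/-- A multi-index with coordinate sum `s` is determined by its last `d - 1` coordinates, each in
`{0, …, s}`. -/
lemma tsum_sum_le {d : ℕ} (hd : 1 ≤ d) (g : ℕ → ℝ≥0∞) :
    ∑' k : Fin d → ℕ, g (∑ q, k q) ≤ ∑' s : ℕ, ((s : ℝ≥0∞) + 1) ^ (d - 1) * g s := by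
  obtain ⟨e, rfl⟩ : ∃ e, d = e + 1 := ⟨d - 1, by omega⟩
  rw [← ENNReal.tsum_fiberwise _ (fun k : Fin (e + 1) → ℕ => ∑ q, k q)]
  refine ENNReal.tsum_le_tsum fun s => ?_
  have h1 : ∀ b : (fun k : Fin (e + 1) → ℕ => ∑ q, k q) ⁻¹' {s},
      g (∑ q, (b : Fin (e + 1) → ℕ) q) = g s := fun b => by rw [show ∑ q, _ = s from b.2]
  simp_rw [h1]
  rw [ENNReal.tsum_const]
  gcongr
  let F : (fun k : Fin (e + 1) → ℕ => ∑ q, k q) ⁻¹' {s} → (Fin e → Fin (s + 1)) := fun b q =>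
    ⟨(b : Fin (e + 1) → ℕ) q.succ, by
      have h : ∑ q, (b : Fin (e + 1) → ℕ) q = s := b.2
      have := Finset.single_le_sum (f := (b : Fin (e + 1) → ℕ)) (fun _ _ => Nat.zero_le _)
        (Finset.mem_univ q.succ)
      omega⟩
  have hF : Function.Injective F := by
    intro a b hab
    have h1 : ∀ q : Fin e, (a : Fin (e + 1) → ℕ) q.succ = (b : Fin (e + 1) → ℕ) q.succ := fun q =>
      Fin.ext_iff.1 (congrFun hab q)
    have ha : ∑ q, (a : Fin (e + 1) → ℕ) q = s := a.2
    have hb : ∑ q, (b : Fin (e + 1) → ℕ) q = s := b.2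
    rw [Fin.sum_univ_succ] at ha hb
    simp_rw [h1] at ha
    apply Subtype.ext
    funext q
    refine Fin.cases ?_ h1 q
    omega
  have h2 := ENat.card_le_card_of_injective hF
  have h3 : (ENat.card (Fin e → Fin (s + 1)) : ℝ≥0∞) = ((s : ℝ≥0∞) + 1) ^ e := by
    rw [ENat.card_eq_coe_fintype_card]
    simp
  rw [Nat.add_sub_cancel, ← h3]
  exact_mod_cast h2

/-- Source of the logarithm in the Orlicz function: each level `s` is shared by at most `(s + 1) ^
(d - 1)` blocks, and `s + 1` is logarithmic in `y` as soon as `lev s < y`. -/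
lemma tsum_lev_sum_lt_le {d : ℕ} (hd : 1 ≤ d) {α : ℝ} (hα : 0 < α) :
    ∃ C : ℝ≥0∞, C ≠ ⊤ ∧ ∀ y : ℝ, 0 ≤ y →
      ∑' k : Fin d → ℕ, (if lev (∑ q, k q) < y then ENNReal.ofReal (lev (∑ q, k q) ^ α) else 0) ≤
        C * ENNReal.ofReal ((1 + Real.log (1 + y)) ^ (d - 1) * y ^ α) := by
  refine ⟨ENNReal.ofReal (20 ^ (d - 1)) * ENNReal.ofReal (1 / (1 - (19 / 20 : ℝ) ^ α)), by finiteness,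
    fun y hy => ?_⟩
  have hlog : 0 ≤ Real.log (1 + y) := Real.log_nonneg (by linarith)
  refine (tsum_sum_le hd fun s => if lev s < y then ENNReal.ofReal (lev s ^ α) else 0).trans ?_
  calc _ ≤ ∑' s, ENNReal.ofReal ((20 * (1 + Real.log (1 + y))) ^ (d - 1)) *
          (if lev s < y then ENNReal.ofReal (lev s ^ α) else 0) := by
        refine ENNReal.tsum_le_tsum fun s => ?_
        split_ifs with h
        · gcongr
          rw [ENNReal.ofReal_pow (by positivity)]
          gcongr
          have := ENNReal.ofReal_le_ofReal (add_one_le_of_lev_lt h)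
          rwa [ENNReal.ofReal_add (by positivity) zero_le_one, ENNReal.ofReal_natCast,
            ENNReal.ofReal_one] at this
        · simp
    _ ≤ ENNReal.ofReal ((20 * (1 + Real.log (1 + y))) ^ (d - 1)) *
        (ENNReal.ofReal (1 / (1 - (19 / 20 : ℝ) ^ α)) * ENNReal.ofReal (y ^ α)) := by
        rw [ENNReal.tsum_mul_left]
        gcongr
        exact tsum_lev_lt_le hα y
    _ = _ := by
        rw [mul_pow, ENNReal.ofReal_mul (by positivity), ENNReal.ofReal_mul (by positivity)]
        ring

/-! ### Doob's inequality -/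

section Doob

variable {Ω : Type*} [MeasurableSpace Ω] {μ : Measure Ω} [IsProbabilityMeasure μ]

lemma integrable_of_bounded {f : Ω → ℝ} (hf : Measurable f) (hb : ∃ B, ∀ ω, |f ω| ≤ B) :
    Integrable f μ := by
  obtain ⟨B, hB⟩ := hb
  exact Integrable.of_bound hf.aestronglyMeasurable B (.of_forall hB)

lemma Submartingale.integral_mul_le_succ {𝓕 : Filtration ℕ ‹MeasurableSpace Ω›} {f : ℕ → Ω → ℝ}
    (hf : Submartingale f 𝓕 μ) {t : ℕ} {m : Ω → ℝ} (hm : StronglyMeasurable[𝓕 t] m)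
    (h0 : 0 ≤ m) (hb : ∃ B, ∀ ω, |m ω| ≤ B) :
    ∫ ω, m ω * f t ω ∂μ ≤ ∫ ω, m ω * f (t + 1) ω ∂μ := by
  obtain ⟨B, hB⟩ := hb
  have hint : ∀ s, Integrable (m * f s) μ := fun s =>
    (hf.integrable s).bdd_mul (hm.mono (𝓕.le t)).aestronglyMeasurable (c := B) (.of_forall hB)
  have h1 : μ[m * f (t + 1) | 𝓕 t] =ᵐ[μ] m * μ[f (t + 1) | 𝓕 t] :=
    condExp_mul_of_stronglyMeasurable_left hm (hint _) (hf.integrable _)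
  calc ∫ ω, m ω * f t ω ∂μ ≤ ∫ ω, (μ[m * f (t + 1) | 𝓕 t]) ω ∂μ := by
        refine integral_mono_ae (hint t) integrable_condExp ?_
        filter_upwards [h1, hf.ae_le_condExp (Nat.le_succ t)] with ω h1 h2
        rw [h1]
        exact mul_le_mul_of_nonneg_left h2 (h0 ω)
    _ = _ := integral_condExp (𝓕.le t)

/-- **Doob's `L²` inequality** for bounded nonnegative submartingales. -/
lemma Submartingale.integral_partialSups_sq_le {𝓕 : Filtration ℕ ‹MeasurableSpace Ω›}
    {f : ℕ → Ω → ℝ} (hf : Submartingale f 𝓕 μ) (h0 : ∀ t, 0 ≤ f t)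
    (hb : ∀ t, ∃ B, ∀ ω, |f t ω| ≤ B) (T : ℕ) :
    ∫ ω, (partialSups f T ω) ^ 2 ∂μ ≤ 4 * ∫ ω, (f T ω) ^ 2 ∂μ := by
  have hm0 : ∀ t, 0 ≤ partialSups f t := fun t => (h0 t).trans (le_partialSups f t)
  have hmb : ∀ t, ∃ B, ∀ ω, |partialSups f t ω| ≤ B := by
    intro t
    induction t with
    | zero => simpa using hb 0
    | succ t ih =>
      obtain ⟨B, hB⟩ := ih
      obtain ⟨B', hB'⟩ := hb (t + 1)
      refine ⟨max B B', fun ω => ?_⟩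
      rw [partialSups_add_one, Pi.sup_apply]
      exact abs_max_le_max_abs_abs.trans (max_le_max (hB ω) (hB' ω))
  have hms : ∀ t, StronglyMeasurable[𝓕 t] (partialSups f t) := by
    intro t
    induction t with
    | zero => simpa using hf.stronglyMeasurable 0
    | succ t ih =>
      rw [partialSups_add_one]
      exact @StronglyMeasurable.sup _ _ _ _ (𝓕 (t + 1)) _ _ _ (ih.mono (𝓕.mono (Nat.le_succ t)))
        (hf.stronglyMeasurable _)
  have hmm : ∀ t, Measurable (partialSups f t) := fun t => ((hms t).mono (𝓕.le t)).measurable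
  have hfm : ∀ t, Measurable (f t) := fun t => ((hf.stronglyMeasurable t).mono (𝓕.le t)).measurable
  have hbmul : ∀ {u v : Ω → ℝ}, (∃ B, ∀ ω, |u ω| ≤ B) → (∃ B, ∀ ω, |v ω| ≤ B) →
      ∃ B, ∀ ω, |u ω * v ω| ≤ B := by
    rintro u v ⟨B, hB⟩ ⟨B', hB'⟩
    refine ⟨B * B', fun ω => ?_⟩
    rw [abs_mul]
    exact mul_le_mul (hB ω) (hB' ω) (abs_nonneg _) ((abs_nonneg _).trans (hB ω))
  have hi1 : ∀ t s, Integrable (fun ω => partialSups f t ω * f s ω) μ := fun t s =>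
    integrable_of_bounded ((hmm t).mul (hfm s)) (hbmul (hmb t) (hb s))
  have hi2 : ∀ t, Integrable (fun ω => partialSups f t ω ^ 2) μ := fun t => by
    simp_rw [sq]; exact integrable_of_bounded ((hmm t).mul (hmm t)) (hbmul (hmb t) (hmb t))
  have hi3 : Integrable (fun ω => f T ω ^ 2) μ := by
    simp_rw [sq]; exact integrable_of_bounded ((hfm T).mul (hfm T)) (hbmul (hb T) (hb T))
  -- With `M` the running maximum, `M_{t+1}²/2 - M_{t+1} f_{t+1} ≤ M_t²/2 - M_t f_{t+1}` pointwise,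
  -- and the submartingale property replaces `f_{t+1}` by `f_t` in expectation. So the expectation
  -- stays nonpositive.
  have key : ∀ t, ∫ ω, (partialSups f t ω ^ 2 / 2 - partialSups f t ω * f t ω) ∂μ ≤ 0 := by
    intro t
    induction t with
    | zero =>
      refine integral_nonpos fun ω => ?_
      simp only [partialSups_zero, Pi.zero_apply]
      nlinarith [sq_nonneg (f 0 ω)]
    | succ t ih =>
      have h1 := Submartingale.integral_mul_le_succ hf (hms t) (hm0 t) (hmb t)
      calc _ ≤ ∫ ω, ((partialSups f t ω ^ 2 / 2 - partialSups f t ω * f t ω) -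
            (partialSups f t ω * f (t + 1) ω - partialSups f t ω * f t ω)) ∂μ := by
            refine integral_mono (((hi2 _).div_const 2).sub (hi1 _ _))
              ((((hi2 _).div_const 2).sub (hi1 _ _)).sub ((hi1 _ _).sub (hi1 _ _))) fun ω => ?_
            simp only [partialSups_add_one, Pi.sup_apply]
            rcases le_total (partialSups f t ω) (f (t + 1) ω) with h | h
            · rw [sup_eq_right.2 h]
              nlinarith [sq_nonneg (partialSups f t ω - f (t + 1) ω)]
            · rw [sup_eq_left.2 h]; linarith
        _ = _ := integral_sub (((hi2 _).div_const 2).sub (hi1 _ _)) ((hi1 _ _).sub (hi1 _ _))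
        _ ≤ 0 := by
            rw [integral_sub (hi1 _ _) (hi1 _ _)]; linarith
  -- `(M/2 - f)² ≥ 0` gives `M²/4 - f² ≤ M²/2 - M f`.
  have h2 : ∫ ω, (partialSups f T ω ^ 2 / 4 - f T ω ^ 2) ∂μ ≤ 0 := by
    refine le_trans (integral_mono (((hi2 _).div_const 4).sub hi3)
      (((hi2 _).div_const 2).sub (hi1 _ _)) fun ω => ?_) (key T)
    simp only [Pi.sub_apply]
    nlinarith [sq_nonneg (partialSups f T ω / 2 - f T ω)]
  rw [integral_sub ((hi2 _).div_const 4) hi3, integral_div] at h2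
  linarith

lemma Submartingale.finset_sup' {κ : Type*} {𝓕 : Filtration ℕ ‹MeasurableSpace Ω›}
    {f : κ → ℕ → Ω → ℝ} {s : Finset κ} (hs : s.Nonempty) (hf : ∀ k ∈ s, Submartingale (f k) 𝓕 μ) :
    Submartingale (s.sup' hs f) 𝓕 μ := by
  refine Finset.sup'_induction hs f (p := fun g => Submartingale g 𝓕 μ)
    (fun g₁ h₁ g₂ h₂ => h₁.sup h₂) hf

end Doob

/-! ### Multiparameter maximal inequality for exponentials of box sums -/

/-- The sum of the field `Y` over the box `∏ q, {0, …, n q - 1}`. -/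
def boxSum {Ω : Type*} {d : ℕ} (Y : (Fin d → ℕ) → Ω → ℝ) (n : Fin d → ℕ) (ω : Ω) : ℝ :=
  ∑ i ∈ Fintype.piFinset (fun q => Finset.range (n q)), Y i ω

lemma boxSum_eq_zero {Ω : Type*} {d : ℕ} {Y : (Fin d → ℕ) → Ω → ℝ} {n : Fin d → ℕ} {q : Fin d}
    (hq : n q = 0) (ω : Ω) :
    boxSum Y n ω = 0 := by
  unfold boxSum
  rw [Fintype.piFinset_eq_empty.2 ⟨q, by simp [hq]⟩, Finset.sum_empty]

section Maximal

variable {Ω : Type*} [MeasurableSpace Ω] {μ : Measure Ω} {d : ℕ} {Y : (Fin d → ℕ) → Ω → ℝ}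

lemma measurable_boxSum (hm : ∀ i, Measurable (Y i)) (n : Fin d → ℕ) : Measurable (boxSum Y n) :=
  Finset.measurable_fun_sum _ fun i _ => hm i

lemma abs_boxSum_le {B : ℝ} (hB : ∀ i ω, |Y i ω| ≤ B) (n : Fin d → ℕ) (ω : Ω) :
    |boxSum Y n ω| ≤ (∏ q, (n q : ℝ)) * B := by
  refine (Finset.abs_sum_le_sum_abs _ _).trans ((Finset.sum_le_sum fun i _ => hB i ω).trans ?_)
  simp [Fintype.card_piFinset]

/-- The σ-algebras generated by the variables with `q`-th coordinate below a given bound. -/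
def coordFiltration (Y : (Fin d → ℕ) → Ω → ℝ) (hm : ∀ i, Measurable (Y i)) (q : Fin d) :
    Filtration ℕ ‹MeasurableSpace Ω› where
  seq t := ⨆ i ∈ {i : Fin d → ℕ | i q < t}, MeasurableSpace.comap (Y i) inferInstance
  mono' _ _ h := biSup_mono fun _ hi => lt_of_lt_of_le hi h
  le' _ := iSup₂_le fun i _ => (hm i).comap_le

lemma measurable_boxSum_of_subset {I : Set (Fin d → ℕ)} {s : Finset (Fin d → ℕ)}
    (hs : ∀ i ∈ s, i ∈ I) :
    Measurable[⨆ i ∈ I, MeasurableSpace.comap (Y i) inferInstance] fun ω => ∑ i ∈ s, Y i ω := by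
  refine @Finset.measurable_fun_sum _ _ _ _ _ _ (⨆ i ∈ I, MeasurableSpace.comap (Y i) inferInstance)
    _ s fun i hi => ?_
  exact (comap_measurable (Y i)).mono (le_iSup₂_of_le i (hs i hi) le_rfl) le_rfl

lemma boxSum_update_succ (n : Fin d → ℕ) (q : Fin d) (t : ℕ) (ω : Ω) :
    boxSum Y (Function.update n q (t + 1)) ω = boxSum Y (Function.update n q t) ω +
      ∑ i ∈ Fintype.piFinset (fun r => Finset.range (Function.update n q (t + 1) r)) with i q = t,
        Y i ω := by
  unfold boxSum
  rw [← Finset.sum_filter_not_add_sum_filter _ (fun i => i q = t)]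
  congr 1
  refine Finset.sum_congr ?_ fun _ _ => rfl
  ext i
  simp only [Finset.mem_filter, Fintype.mem_piFinset, Finset.mem_range]
  constructor
  · rintro ⟨h, hq⟩ r
    have := h r
    rcases eq_or_ne r q with rfl | hr
    · simp only [Function.update_self] at *; omega
    · simpa [hr] using this
  · intro h
    have hq := h q
    simp only [Function.update_self] at hq
    refine ⟨fun r => ?_, hq.ne⟩
    have := h r
    rcases eq_or_ne r q with rfl | hr
    · simp only [Function.update_self] at *; omega
    · simpa [hr] using this

variable [IsProbabilityMeasure μ]

/-- Lengthening side `q` by one adds a slice `D` that is centered and independent of the past, and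
`E exp D ≥ 1 + E D = 1`. The filtration does not depend on the other sides `n`, so maxima over them
are again submartingales. -/
lemma submartingale_exp_boxSum (hm : ∀ i, Measurable (Y i)) (hi : iIndepFun Y μ) {B : ℝ}
    (hB : ∀ i ω, |Y i ω| ≤ B) (hc : ∀ i, ∫ ω, Y i ω ∂μ = 0) (q : Fin d) (n : Fin d → ℕ) :
    Submartingale (fun t ω => Real.exp (boxSum Y (Function.update n q t) ω))
      (coordFiltration Y hm q) μ := by
  have hint : ∀ n', Integrable (fun ω => Real.exp (boxSum Y n' ω)) μ := fun n' =>
    integrable_of_bounded (measurable_boxSum hm n').exp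
      ⟨Real.exp ((∏ q, (n' q : ℝ)) * B), fun ω => by
        rw [Real.abs_exp]
        exact Real.exp_le_exp.2 ((le_abs_self _).trans (abs_boxSum_le hB _ _))⟩
  have hadp : ∀ t, Measurable[coordFiltration Y hm q t]
      (fun ω => boxSum Y (Function.update n q t) ω) := fun t => by
    refine measurable_boxSum_of_subset fun i hi => ?_
    simp only [Fintype.mem_piFinset, Finset.mem_range] at hi
    simpa using hi q
  refine submartingale_nat (fun t => (Real.measurable_exp.comp (hadp t)).stronglyMeasurable)
    (fun t => hint _) fun t => ?_
  set s := (Fintype.piFinset fun r => Finset.range (Function.update n q (t + 1) r)).filter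
    (fun i => i q = t) with hs
  set D : Ω → ℝ := fun ω => ∑ i ∈ s, Y i ω with hD
  have hDm : Measurable[⨆ i ∈ {i : Fin d → ℕ | i q = t}, MeasurableSpace.comap (Y i) inferInstance]
      D := measurable_boxSum_of_subset fun i hi => (Finset.mem_filter.1 hi).2
  have hle : (⨆ i ∈ {i : Fin d → ℕ | i q = t}, MeasurableSpace.comap (Y i) inferInstance) ≤
      ‹MeasurableSpace Ω› := iSup₂_le fun i _ => (hm i).comap_le
  have hindep := indep_iSup_of_disjoint (fun i => (hm i).comap_le) hi.iIndep
    (S := {i : Fin d → ℕ | i q = t}) (T := {i : Fin d → ℕ | i q < t})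
    (Set.disjoint_left.2 fun i h1 h2 => by
      simp only [Set.mem_ofPred_eq] at h1 h2; omega)
  have hYint : ∀ i, Integrable (Y i) μ := fun i => integrable_of_bounded (hm i) ⟨B, hB i⟩
  have hDi : Integrable D μ := integrable_finsetSum _ fun i _ => hYint i
  have hDe : Integrable (fun ω => Real.exp (D ω)) μ :=
    integrable_of_bounded (hDm.mono hle le_rfl).exp
      ⟨Real.exp (∑ i ∈ s, B), fun ω => by
        rw [Real.abs_exp]
        exact Real.exp_le_exp.2 (Finset.sum_le_sum fun i _ => (le_abs_self _).trans (hB i ω))⟩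
  have h1 : 1 ≤ ∫ ω, Real.exp (D ω) ∂μ := by
    have h0 : ∫ ω, (D ω + 1) ∂μ = 1 := by
      rw [integral_add hDi (integrable_const _), hD, integral_finsetSum _ fun i _ => hYint i]
      simp [hc]
    rw [← h0]
    exact integral_mono (hDi.add (integrable_const _)) hDe fun ω => Real.add_one_le_exp _
  have h2 : μ[fun ω => Real.exp (D ω) | coordFiltration Y hm q t] =ᵐ[μ]
      fun _ => ∫ ω, Real.exp (D ω) ∂μ :=
    condExp_indep_eq hle ((coordFiltration Y hm q).le t)
      (Real.measurable_exp.comp hDm).stronglyMeasurable hindep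
  have heq : (fun ω => Real.exp (boxSum Y (Function.update n q (t + 1)) ω)) =
      (fun ω => Real.exp (boxSum Y (Function.update n q t) ω)) * fun ω => Real.exp (D ω) := by
    ext ω
    simp only [Pi.mul_apply]
    rw [← Real.exp_add, boxSum_update_succ]
  have h3 : μ[(fun ω => Real.exp (boxSum Y (Function.update n q (t + 1)) ω)) |
      coordFiltration Y hm q t] =ᵐ[μ] (fun ω => Real.exp (boxSum Y (Function.update n q t) ω)) *
        μ[fun ω => Real.exp (D ω) | coordFiltration Y hm q t] := by
    rw [heq]
    exact condExp_mul_of_stronglyMeasurable_left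
      (Real.measurable_exp.comp (hadp t)).stronglyMeasurable (heq ▸ hint _) hDe
  filter_upwards [h2, h3] with ω h2 h3
  rw [h3, Pi.mul_apply, h2]
  exact le_mul_of_one_le_right (Real.exp_pos _).le h1

/-- Cairoli's argument: the sides are released one at a time, each release costing the factor 4 of
Doob's inequality. -/
lemma integral_sup'_exp_boxSum_sq_le (hm : ∀ i, Measurable (Y i)) (hi : iIndepFun Y μ) {B : ℝ}
    (hB : ∀ i ω, |Y i ω| ≤ B) (hc : ∀ i, ∫ ω, Y i ω ∂μ = 0) (N : Fin d → ℕ) :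
    ∫ ω, ((Finset.Iic N).sup' Finset.nonempty_Iic fun n => Real.exp (boxSum Y n ω)) ^ 2 ∂μ ≤
      4 ^ d * ∫ ω, Real.exp (boxSum Y N ω) ^ 2 ∂μ := by
  -- `J` is the set of sides over which the maximum is taken; `J.piecewise n N` keeps the remaining
  -- sides at their full length `N`.
  have key : ∀ J : Finset (Fin d),
      ∫ ω, ((Finset.Iic N).sup' Finset.nonempty_Iic
        fun n => Real.exp (boxSum Y (J.piecewise n N) ω)) ^ 2 ∂μ ≤
      4 ^ J.card * ∫ ω, Real.exp (boxSum Y N ω) ^ 2 ∂μ := by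
    intro J
    induction J using Finset.induction_on with
    | empty => simp
    | insert q J hq ih =>
      -- The maximum over the sides in `J`, viewed as a process in the length `t` of the new side
      -- `q`; its running maximum at time `N q` dominates the maximum over `insert q J`.
      set f : ℕ → Ω → ℝ := (Finset.Iic N).sup' Finset.nonempty_Iic fun n t ω =>
        Real.exp (boxSum Y (Function.update (J.piecewise n N) q t) ω) with hf
      have hfa : ∀ t ω, f t ω = (Finset.Iic N).sup' Finset.nonempty_Iic fun n =>
          Real.exp (boxSum Y (Function.update (J.piecewise n N) q t) ω) := fun t ω => by
        rw [hf, Finset.sup'_apply, Finset.sup'_apply]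
      have hsub : Submartingale f (coordFiltration Y hm q) μ :=
        Submartingale.finset_sup' _ fun n _ => submartingale_exp_boxSum hm hi hB hc q _
      have hf0 : ∀ t, 0 ≤ f t := fun t ω => by
        rw [hfa]
        exact (Real.exp_pos _).le.trans (Finset.le_sup' (fun n =>
          Real.exp (boxSum Y (Function.update (J.piecewise n N) q t) ω)) (Finset.mem_Iic.2 le_rfl))
      have hfb : ∀ t, ∃ C, ∀ ω, |f t ω| ≤ C := fun t => by
        refine ⟨(Finset.Iic N).sup' Finset.nonempty_Iic fun n => Real.exp
          ((∏ r, ((Function.update (J.piecewise n N) q t) r : ℝ)) * B), fun ω => ?_⟩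
        rw [abs_of_nonneg (hf0 t ω), hfa]
        exact Finset.sup'_mono_fun fun n _ =>
          Real.exp_le_exp.2 ((le_abs_self _).trans (abs_boxSum_le hB _ _))
      have hdoob := Submartingale.integral_partialSups_sq_le hsub hf0 hfb (N q)
      have hfN : ∀ ω, f (N q) ω = (Finset.Iic N).sup' Finset.nonempty_Iic
          fun n => Real.exp (boxSum Y (J.piecewise n N) ω) := fun ω => by
        rw [hfa]
        congr 1
        ext n
        congr 2
        rw [Function.update_eq_self_iff, Finset.piecewise_eq_of_notMem _ _ _ hq]
      simp_rw [hfN] at hdoob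
      rw [Finset.card_insert_of_notMem hq, pow_succ']
      have hfm : ∀ t, Measurable (f t) := fun t =>
        ((hsub.stronglyMeasurable t).mono ((coordFiltration Y hm q).le t)).measurable
      have hpm : ∀ t, Measurable (partialSups f t) ∧ ∃ C, ∀ ω, |partialSups f t ω| ≤ C := by
        intro t
        induction t with
        | zero => simpa using ⟨hfm 0, hfb 0⟩
        | succ t ih =>
          obtain ⟨h, C, hC⟩ := ih
          obtain ⟨C', hC'⟩ := hfb (t + 1)
          refine ⟨by rw [partialSups_add_one]; exact h.sup (hfm _), max C C', fun ω => ?_⟩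
          rw [partialSups_add_one, Pi.sup_apply]
          exact abs_max_le_max_abs_abs.trans (max_le_max (hC ω) (hC' ω))
      refine le_trans (integral_mono_of_nonneg (.of_forall fun ω => sq_nonneg _) ?_
        (.of_forall fun ω => ?_)) (hdoob.trans ?_)
      · obtain ⟨h, C, hC⟩ := hpm (N q)
        refine integrable_of_bounded (h.pow_const 2) ⟨C ^ 2, fun ω => ?_⟩
        rw [abs_pow]
        exact pow_le_pow_left₀ (abs_nonneg _) (hC ω) 2
      · refine pow_le_pow_left₀ ?_ ?_ 2
        · exact (Real.exp_pos _).le.trans (Finset.le_sup' (fun n =>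
            Real.exp (boxSum Y ((insert q J).piecewise n N) ω)) (Finset.mem_Iic.2 le_rfl))
        · refine Finset.sup'_le _ _ fun n hn => ?_
          rw [Finset.piecewise_insert]
          refine le_trans ?_ (le_partialSups_of_le f (Finset.mem_Iic.1 hn q) ω)
          rw [hfa]
          exact Finset.le_sup' (fun n' => Real.exp
            (boxSum Y (Function.update (J.piecewise n' N) q (n q)) ω)) hn
      · rw [mul_assoc]
        exact mul_le_mul_of_nonneg_left ih (by norm_num)
  have := key Finset.univ
  simpa using this

end Maximal

/-! ### Moments of sums of independent nonnegative variables -/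

/-- **Jensen's inequality** for a power of exponent at most one. -/
lemma lintegral_rpow_le_rpow_lintegral {Ω : Type*} [MeasurableSpace Ω] {μ : Measure Ω}
    [IsProbabilityMeasure μ] {f : Ω → ℝ≥0∞} (hf : AEMeasurable f μ) {q : ℝ} (hq0 : 0 < q)
    (hq1 : q ≤ 1) : ∫⁻ ω, f ω ^ q ∂μ ≤ (∫⁻ ω, f ω ∂μ) ^ q := by
  have h := eLpNorm'_le_eLpNorm'_of_exponent_le hq0 hq1 μ hf.aestronglyMeasurable
  simp only [eLpNorm', enorm_eq_self, ENNReal.rpow_one, div_one] at h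
  rwa [one_div, ENNReal.rpow_inv_le_iff hq0] at h

/-- Independent nonnegative variables satisfy `E (∑ ξ) ^ p ≤ ∑ E ξ ^ p + (∑ E ξ) ^ p`
when `1 < p ≤ 2`. -/
lemma lintegral_sum_rpow_le {Ω ι : Type*} [MeasurableSpace Ω] {μ : Measure Ω}
    [IsProbabilityMeasure μ] {ξ : ι → Ω → ℝ≥0∞} (hm : ∀ i, Measurable (ξ i))
    (hi : iIndepFun ξ μ) {p : ℝ} (hp1 : 1 < p) (hp2 : p ≤ 2) (s : Finset ι) :
    ∫⁻ ω, (∑ i ∈ s, ξ i ω) ^ p ∂μ ≤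
      ∑ i ∈ s, ∫⁻ ω, ξ i ω ^ p ∂μ + (∑ i ∈ s, ∫⁻ ω, ξ i ω ∂μ) ^ p := by
  classical
  have hq0 : 0 < p - 1 := by linarith
  have hmul : ∀ x : ℝ≥0∞, x * x ^ (p - 1) = x ^ p := fun x => by
    nth_rw 1 [← ENNReal.rpow_one x]
    rw [← ENNReal.rpow_add_of_nonneg _ _ zero_le_one hq0.le]; congr 1; ring
  -- Write `S ^ p = ∑ ξ i * S ^ (p - 1)` and use subadditivity of `x ^ (p - 1)` to separate `ξ i`
  -- from the sum of the others, which is independent of it.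
  have hpt : ∀ ω, (∑ i ∈ s, ξ i ω) ^ p ≤
      ∑ i ∈ s, (ξ i ω ^ p + ξ i ω * (∑ j ∈ s.erase i, ξ j ω) ^ (p - 1)) := by
    intro ω
    rw [← hmul, Finset.sum_mul]
    refine Finset.sum_le_sum fun i his => ?_
    rw [← hmul (ξ i ω), ← mul_add, ← Finset.add_sum_erase s (fun j => ξ j ω) his]
    gcongr
    exact ENNReal.rpow_add_le_add_rpow _ _ hq0.le (by linarith)
  have hmS : ∀ t : Finset ι, Measurable fun ω => ∑ j ∈ t, ξ j ω := fun t =>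
    Finset.measurable_fun_sum _ fun j _ => hm j
  calc _ ≤ ∫⁻ ω, ∑ i ∈ s, (ξ i ω ^ p + ξ i ω * (∑ j ∈ s.erase i, ξ j ω) ^ (p - 1)) ∂μ :=
        lintegral_mono hpt
    _ = ∑ i ∈ s, (∫⁻ ω, ξ i ω ^ p ∂μ +
        ∫⁻ ω, ξ i ω * (∑ j ∈ s.erase i, ξ j ω) ^ (p - 1) ∂μ) := by
        rw [lintegral_finsetSum s (fun i _ => ((hm i).pow_const p).fun_add
          ((hm i).fun_mul ((hmS (s.erase i)).pow_const (p - 1))))]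
        refine Finset.sum_congr rfl fun i _ => ?_
        rw [lintegral_add_left ((hm i).pow_const _)]
    _ ≤ ∑ i ∈ s, (∫⁻ ω, ξ i ω ^ p ∂μ +
        (∫⁻ ω, ξ i ω ∂μ) * (∑ j ∈ s, ∫⁻ ω, ξ j ω ∂μ) ^ (p - 1)) := by
        refine Finset.sum_le_sum fun i _ => ?_
        gcongr
        have hind : IndepFun (ξ i) (fun ω => ∑ j ∈ s.erase i, ξ j ω) μ := by
          have := (hi.indepFun_finsetSum_of_notMem hm (Finset.notMem_erase i s)).symm
          convert this using 1
          ext ω; simp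
        have hind2 := hind.comp (φ := id) (ψ := fun x : ℝ≥0∞ => x ^ (p - 1)) measurable_id
          (measurable_id.pow_const _)
        rw [show (∫⁻ ω, ξ i ω * (∑ j ∈ s.erase i, ξ j ω) ^ (p - 1) ∂μ) = ∫⁻ ω, (ξ i *
          fun ω => (∑ j ∈ s.erase i, ξ j ω) ^ (p - 1)) ω ∂μ from rfl,
          lintegral_mul_eq_lintegral_mul_lintegral_of_indepFun (hm i) ((hmS _).pow_const _) hind2]
        gcongr
        refine (lintegral_rpow_le_rpow_lintegral (hmS _).aemeasurable hq0 (by linarith)).trans ?_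
        gcongr
        rw [lintegral_finsetSum _ fun j _ => hm j]
        exact Finset.sum_le_sum_of_subset (Finset.erase_subset _ _)
    _ = _ := by
        rw [Finset.sum_add_distrib, ← Finset.sum_mul, hmul]

/-! ### Bounded fields over a dyadic block -/

/-- The normalization `√(2 ^ s * wt s)` of a dyadic block. -/
noncomputable def psi (s : ℕ) : ℝ := Real.sqrt (2 ^ s * wt s)

lemma psi_pos (s : ℕ) : 0 < psi s := Real.sqrt_pos.2 (mul_pos (by positivity) (wt_pos s))

lemma psi_eq (s : ℕ) : psi s = wt s * lev s := by
  have h := wt_pos s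
  rw [psi, lev, show (2 : ℝ) ^ s * wt s = wt s ^ 2 * (2 ^ s / wt s) by field_simp,
    Real.sqrt_mul (by positivity), Real.sqrt_sq h.le]

lemma lev_sq (s : ℕ) : lev s ^ 2 = 2 ^ s / wt s :=
  Real.sq_sqrt (div_nonneg (by positivity) (wt_pos s).le)

lemma two_pow_div_psi (s : ℕ) : 2 ^ s / psi s = lev s := by
  have h := wt_pos s
  have h1 := lev_pos s
  have h2 := lev_sq s
  rw [psi_eq, div_eq_iff (by positivity)]
  field_simp at h2
  linarith

/-- The left side equals `wt s ^ (1 - p) * lev s ^ (2 - p)`, and `wt s ≥ 1`. -/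
lemma two_pow_div_psi_rpow_le (s : ℕ) {p : ℝ} (hp : 1 ≤ p) :
    2 ^ s / psi s ^ p ≤ lev s ^ (2 - p) := by
  have h := wt_pos s
  have h1 := lev_pos s
  have h3 : (2 : ℝ) ^ s = wt s * lev s ^ 2 := by rw [lev_sq]; field_simp
  rw [psi_eq, Real.mul_rpow h.le h1.le, h3, Real.rpow_sub h1, Real.rpow_two, mul_div_mul_comm]
  refine mul_le_of_le_one_left (by positivity) ?_
  rw [div_le_one (by positivity)]
  exact Real.self_le_rpow_of_one_le (one_le_wt s) hp

/-- For `x = u - t ≥ 0`, `x ^ p ≤ 1 + x ^ 2 ≤ 9 * exp (x / 2) ≤ 9 * exp (w * x / 2)`. This trades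
the moment of an excess for an exponential moment. -/
lemma rpow_max_sub_le {p : ℝ} (hp1 : 1 ≤ p) (hp2 : p ≤ 2) {w : ℝ} (hw : 1 ≤ w) (t u : ℝ) :
    (max (u - t) 0) ^ p ≤ 9 * (Real.exp (-(w * t / 2)) * Real.exp (w / 2 * u)) := by
  rw [← Real.exp_add]
  rcases le_total (u - t) 0 with h | h
  · rw [max_eq_right h, Real.zero_rpow (by linarith)]; positivity
  rw [max_eq_left h]
  set x := u - t with hx
  have h1 : x ^ p ≤ 1 + x ^ 2 := by
    rcases le_total x 1 with h2 | h2
    · nlinarith [Real.rpow_le_one h h2 (by linarith : 0 ≤ p), sq_nonneg x]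
    · have := Real.rpow_le_rpow_of_exponent_le h2 hp2
      rw [Real.rpow_two] at this; linarith
  have h2 : 1 + x ^ 2 ≤ 9 * Real.exp (x / 2) := by
    have := Real.quadratic_le_exp_of_nonneg (by linarith : 0 ≤ x / 2)
    nlinarith
  refine (h1.trans h2).trans (mul_le_mul_of_nonneg_left (Real.exp_le_exp.2 ?_) (by norm_num))
  nlinarith

section Bounded

variable {Ω : Type*} [MeasurableSpace Ω] {μ : Measure Ω} [IsProbabilityMeasure μ] {d : ℕ}

/-- The parameter `1 / (2 * b)` keeps the exponent in `[-1, 1]`, where `exp x ≤ 1 + x + x ^ 2`; the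
linear term vanishes and the variance is at most one. -/
lemma integral_exp_center_le {Z : Ω → ℝ} (hm : Measurable Z) {b : ℝ} (hb : 0 < b)
    (hZ : ∀ ω, |Z ω| ≤ b) (h2 : ∫ ω, Z ω ^ 2 ∂μ ≤ 1) :
    ∫ ω, Real.exp (1 / (2 * b) * (Z ω - ∫ ω, Z ω ∂μ)) ∂μ ≤ Real.exp ((1 / (2 * b)) ^ 2) := by
  set l := 1 / (2 * b) with hl
  set a := ∫ ω, Z ω ∂μ with ha
  have hZi : Integrable Z μ := integrable_of_bounded hm ⟨b, hZ⟩
  have hZ2 : Integrable (fun ω => Z ω ^ 2) μ := integrable_of_bounded (hm.pow_const 2)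
    ⟨b ^ 2, fun ω => by rw [abs_pow]; exact pow_le_pow_left₀ (abs_nonneg _) (hZ ω) 2⟩
  have hab : |a| ≤ b := by
    have := norm_integral_le_of_norm_le_const (μ := μ) (f := Z) (C := b) (.of_forall hZ)
    simpa using this
  have hx : ∀ ω, |l * (Z ω - a)| ≤ 1 := fun ω => by
    rw [abs_mul, hl, abs_of_pos (by positivity), one_div, inv_mul_le_iff₀ (by positivity)]
    have := abs_sub (Z ω) a
    linarith [hZ ω]
  have hpt : ∀ ω, Real.exp (l * (Z ω - a)) ≤
      1 + l * (Z ω - a) + l ^ 2 * (Z ω ^ 2 - 2 * a * Z ω + a ^ 2) := fun ω => by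
    have := (abs_le.1 (Real.abs_exp_sub_one_sub_id_le (hx ω))).2
    nlinarith
  have hi0 : Integrable (fun ω => l * (Z ω - a)) μ := (hZi.sub (integrable_const a)).const_mul l
  have hi1 : Integrable (fun ω => 1 + l * (Z ω - a)) μ := (integrable_const _).add hi0
  have hi2 : Integrable (fun ω => Z ω ^ 2 - 2 * a * Z ω) μ := hZ2.sub (hZi.const_mul _)
  have hi3 : Integrable (fun ω => l ^ 2 * (Z ω ^ 2 - 2 * a * Z ω + a ^ 2)) μ :=
    (hi2.add (integrable_const _)).const_mul _
  calc _ ≤ ∫ ω, (1 + l * (Z ω - a) + l ^ 2 * (Z ω ^ 2 - 2 * a * Z ω + a ^ 2)) ∂μ :=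
        integral_mono_of_nonneg (.of_forall fun ω => (Real.exp_pos _).le) (hi1.add hi3)
          (.of_forall hpt)
    _ = 1 + l ^ 2 * (∫ ω, Z ω ^ 2 ∂μ - a ^ 2) := by
        rw [integral_add hi1 hi3, integral_add (integrable_const _) hi0,
          integral_const_mul, integral_const_mul,
          integral_sub hZi (integrable_const a), integral_add hi2 (integrable_const _),
          integral_sub hZ2 (hZi.const_mul _), integral_const_mul]
        simp only [integral_const, probReal_univ, smul_eq_mul, ← ha]
        ring
    _ ≤ 1 + l ^ 2 := by nlinarith [sq_nonneg a, sq_nonneg l]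
    _ ≤ _ := by linarith [Real.add_one_le_exp (l ^ 2)]

lemma card_box (N : Fin d → ℕ) :
    (Fintype.piFinset fun q => Finset.range (N q)).card = ∏ q, N q := by
  simp [Fintype.card_piFinset]

/-- The maximal inequality squares the exponential, so starting from `1 / (4 * b)` leads to the
parameter `1 / (2 * b)` of the one-variable bound. -/
lemma lintegral_sup'_exp_center_le {Z : (Fin d → ℕ) → Ω → ℝ} (hm : ∀ i, Measurable (Z i))
    (hi : iIndepFun Z μ) {b : ℝ} (hb : 0 < b) (hZ : ∀ i ω, |Z i ω| ≤ b)
    (h2 : ∀ i, ∫ ω, Z i ω ^ 2 ∂μ ≤ 1) (N : Fin d → ℕ) :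
    ∫⁻ ω, ENNReal.ofReal (((Finset.Iic N).sup' Finset.nonempty_Iic fun n =>
        Real.exp (1 / (4 * b) * boxSum (fun i ω => Z i ω - ∫ ω, Z i ω ∂μ) n ω)) ^ 2) ∂μ ≤
      ENNReal.ofReal (4 ^ d * Real.exp ((1 / (2 * b)) ^ 2 * ∏ q, (N q : ℝ))) := by
  set T : (Fin d → ℕ) → Ω → ℝ := fun i ω => Z i ω - ∫ ω, Z i ω ∂μ with hT
  set Y : (Fin d → ℕ) → Ω → ℝ := fun i ω => 1 / (4 * b) * T i ω with hY
  have hab : ∀ i, |∫ ω, Z i ω ∂μ| ≤ b := fun i => by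
    have := norm_integral_le_of_norm_le_const (μ := μ) (f := Z i) (C := b) (.of_forall (hZ i))
    simpa using this
  have hTm : ∀ i, Measurable (T i) := fun i => (hm i).sub_const _
  have hYm : ∀ i, Measurable (Y i) := fun i => (hTm i).const_mul _
  have hTi : iIndepFun T μ := hi.comp (fun i x => x - ∫ ω, Z i ω ∂μ)
    fun i => measurable_id.sub_const _
  have hYi : iIndepFun Y μ := hTi.comp (fun i x => 1 / (4 * b) * x)
    fun i => measurable_id.const_mul _
  have hZi : ∀ i, Integrable (Z i) μ := fun i => integrable_of_bounded (hm i) ⟨b, hZ i⟩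
  have hYb : ∀ i ω, |Y i ω| ≤ 1 := fun i ω => by
    rw [hY, abs_mul, abs_of_pos (by positivity), one_div, inv_mul_le_iff₀ (by positivity)]
    have := abs_sub (Z i ω) (∫ ω, Z i ω ∂μ)
    linarith [hZ i ω, hab i]
  have hYc : ∀ i, ∫ ω, Y i ω ∂μ = 0 := fun i => by
    rw [hY, integral_const_mul, hT, integral_sub (hZi i) (integrable_const _)]
    simp
  have hbs : ∀ n ω, 1 / (4 * b) * boxSum T n ω = boxSum Y n ω := fun n ω => Finset.mul_sum _ _ _
  simp_rw [hbs]
  have hmax := integral_sup'_exp_boxSum_sq_le hYm hYi hYb hYc N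
  have hmgf : ∫ ω, Real.exp (boxSum Y N ω) ^ 2 ∂μ ≤
      Real.exp ((1 / (2 * b)) ^ 2 * ∏ q, (N q : ℝ)) := by
    have h := hTi.mgf_sum hTm (Fintype.piFinset fun q => Finset.range (N q)) (t := 1 / (2 * b))
    have h3 : ∫ ω, Real.exp (boxSum Y N ω) ^ 2 ∂μ =
        mgf (∑ i ∈ Fintype.piFinset fun q => Finset.range (N q), T i) μ (1 / (2 * b)) := by
      unfold mgf
      refine integral_congr_ae (.of_forall fun ω => ?_)
      simp only [← hbs, Finset.sum_apply, ← Real.exp_nat_mul]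
      congr 1
      simp only [boxSum]
      push_cast
      field_simp
      ring
    rw [h3, h]
    calc _ ≤ ∏ i ∈ Fintype.piFinset fun q => Finset.range (N q), Real.exp ((1 / (2 * b)) ^ 2) :=
          Finset.prod_le_prod (fun i _ => mgf_nonneg) fun i _ =>
            integral_exp_center_le (hm i) hb (hZ i) (h2 i)
      _ = _ := by
          rw [Finset.prod_const, card_box, ← Real.exp_nat_mul]
          push_cast
          rw [mul_comm]
  have hSm : Measurable fun ω => ((Finset.Iic N).sup' Finset.nonempty_Iic fun n =>
      Real.exp (boxSum Y n ω)) := by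
    have := Finset.measurable_sup' (Finset.nonempty_Iic (a := N))
      (fun n _ => (measurable_boxSum hYm n).exp)
    convert this using 1
    ext ω
    rw [Finset.sup'_apply]
  have hSi : Integrable (fun ω => ((Finset.Iic N).sup' Finset.nonempty_Iic fun n =>
      Real.exp (boxSum Y n ω)) ^ 2) μ := by
    refine integrable_of_bounded (hSm.pow_const 2)
      ⟨((Finset.Iic N).sup' Finset.nonempty_Iic fun n => Real.exp ((∏ q, (n q : ℝ)) * 1)) ^ 2,
        fun ω => ?_⟩
    rw [abs_of_nonneg (sq_nonneg _)]
    refine pow_le_pow_left₀ ?_ ?_ 2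
    · exact (Real.exp_pos _).le.trans (Finset.le_sup' (fun n =>
            Real.exp (boxSum Y n ω)) (Finset.mem_Iic.2 le_rfl))
    · exact Finset.sup'_mono_fun fun n _ =>
          Real.exp_le_exp.2 ((le_abs_self _).trans (abs_boxSum_le hYb _ _))
  rw [← ofReal_integral_eq_lintegral_ofReal hSi (.of_forall fun ω => sq_nonneg _)]
  exact ENNReal.ofReal_le_ofReal
    (hmax.trans (mul_le_mul_of_nonneg_left hmgf (by positivity)))

/-- Moments of the excess of the normalized maximum of bounded centered partial sums
over a dyadic block. -/
lemma lintegral_iSup_excess_le {Z : (Fin d → ℕ) → Ω → ℝ} (hm : ∀ i, Measurable (Z i))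
    (hi : iIndepFun Z μ) {k : Fin d → ℕ} (hZ : ∀ i ω, |Z i ω| ≤ lev (∑ q, k q))
    (h2 : ∀ i, ∫ ω, Z i ω ^ 2 ∂μ ≤ 1) {p : ℝ} (hp1 : 1 ≤ p) (hp2 : p ≤ 2) :
    ∫⁻ ω, ⨆ n ∈ Finset.Iic (fun q => 2 ^ (k q + 1)),
        ENNReal.ofReal (|boxSum (fun i ω => Z i ω - ∫ ω, Z i ω ∂μ) n ω| / psi (∑ q, k q) -
          (2 ^ d + 2 * (d + 1))) ^ p ∂μ ≤
      ENNReal.ofReal (18 * 4 ^ d) * ((((∑ q, k q : ℕ) : ℝ≥0∞) + 1) ^ (d + 1))⁻¹ := by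
  set s := ∑ q, k q with hs
  -- In the exponent `wt s * t / 2`, the part `2 ^ d / 2` absorbs the exponential moment `2 ^ d / 4
  -- * wt s`, and the rest leaves `exp (-(d + 1) * wt s)`, a power `-(d + 1)` of `e * (s + 1)`.
  set t : ℝ := 2 ^ d + 2 * (d + 1) with ht
  set N : Fin d → ℕ := fun q => 2 ^ (k q + 1) with hN
  have hb := lev_pos s
  have hw := one_le_wt s
  have hψ := psi_pos s
  have hNprod : ∏ q, (N q : ℝ) = 2 ^ d * 2 ^ s := by
    simp only [hN, pow_succ]
    push_cast
    rw [Finset.prod_mul_distrib, Finset.prod_pow_eq_pow_sum, ← hs]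
    simp [mul_comm]
  -- The level is chosen for this: the number of sites divided by `lev s ^ 2` is a multiple of `wt
  -- s`.
  have hexp : (1 / (2 * lev s)) ^ 2 * ∏ q, (N q : ℝ) = 2 ^ d / 4 * wt s := by
    have h0 := wt_pos s
    rw [hNprod, one_div, inv_pow, mul_pow, lev_sq]
    field_simp
    norm_num
  have hpos := lintegral_sup'_exp_center_le hm hi hb hZ h2 N
  have hneg := lintegral_sup'_exp_center_le (Z := fun i ω => -Z i ω) (fun i => (hm i).neg)
    (hi.comp (fun _ x => -x) fun _ => measurable_neg) hb (fun i ω => by simpa using hZ i ω)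
    (fun i => by simpa using h2 i) N
  set T : (Fin d → ℕ) → Ω → ℝ := fun i ω => Z i ω - ∫ ω, Z i ω ∂μ with hT
  have hTn : ∀ n ω, boxSum (fun i ω => -Z i ω - ∫ ω, -Z i ω ∂μ) n ω = -boxSum T n ω := fun n ω => by
    simp only [boxSum, hT, integral_neg, ← Finset.sum_neg_distrib]
    exact Finset.sum_congr rfl fun i _ => by ring
  simp_rw [hTn] at hneg
  -- `P` and `Q` control the positive and the negative deviations respectively.
  set P : Ω → ℝ := fun ω => ((Finset.Iic N).sup' Finset.nonempty_Iic fun n =>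
        Real.exp (1 / (4 * lev s) * boxSum T n ω)) ^ 2 with hP
  set Q : Ω → ℝ := fun ω => ((Finset.Iic N).sup' Finset.nonempty_Iic fun n =>
        Real.exp (1 / (4 * lev s) * -boxSum T n ω)) ^ 2 with hQ
  have hTm : ∀ i, Measurable (T i) := fun i => (hm i).sub_const _
  have hPm : Measurable P := by
    have := Finset.measurable_sup' (Finset.nonempty_Iic (a := N))
      (fun n _ => ((measurable_boxSum hTm n).const_mul (1 / (4 * lev s))).exp)
    convert this.pow_const 2 using 1
    ext ω
    simp only [hP, Finset.sup'_apply]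
  have hmax : ∀ x : ℝ, ENNReal.ofReal x = ENNReal.ofReal (max x 0) := fun x => by
    simp [ENNReal.ofReal_max]
  have hpt : ∀ ω, ⨆ n ∈ Finset.Iic N, ENNReal.ofReal (|boxSum T n ω| / psi s - t) ^ p ≤
      ENNReal.ofReal (9 * Real.exp (-(wt s * t / 2))) *
        (ENNReal.ofReal (P ω) + ENNReal.ofReal (Q ω)) := by
    intro ω
    refine iSup₂_le fun n hn => ?_
    rw [← ENNReal.ofReal_add (sq_nonneg _) (sq_nonneg _), ← ENNReal.ofReal_mul (by positivity),
      hmax, ENNReal.ofReal_rpow_of_nonneg (le_max_right _ _) (by linarith)]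
    refine ENNReal.ofReal_le_ofReal ((rpow_max_sub_le hp1 hp2 hw _ _).trans ?_)
    rw [mul_assoc]
    refine mul_le_mul_of_nonneg_left (mul_le_mul_of_nonneg_left ?_ (Real.exp_pos _).le) (by norm_num)
    have he : wt s / 2 * (|boxSum T n ω| / psi s) = 2 * (1 / (4 * lev s) * |boxSum T n ω|) := by
      rw [psi_eq]
      have h0 := wt_pos s
      field_simp
      ring
    have hPn : Real.exp (1 / (4 * lev s) * boxSum T n ω) ^ 2 ≤ P ω :=
      pow_le_pow_left₀ (Real.exp_pos _).le (Finset.le_sup' (fun n =>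
        Real.exp (1 / (4 * lev s) * boxSum T n ω)) hn) 2
    have hQn : Real.exp (1 / (4 * lev s) * -boxSum T n ω) ^ 2 ≤ Q ω :=
      pow_le_pow_left₀ (Real.exp_pos _).le (Finset.le_sup' (fun n =>
        Real.exp (1 / (4 * lev s) * -boxSum T n ω)) hn) 2
    have h3 : Real.exp (2 * (1 / (4 * lev s) * |boxSum T n ω|)) =
        Real.exp (1 / (4 * lev s) * |boxSum T n ω|) ^ 2 := by
      rw [← Real.exp_nat_mul]; norm_num
    rw [he, h3]
    rcases abs_cases (boxSum T n ω) with ⟨h, _⟩ | ⟨h, _⟩ <;> rw [h]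
    · exact hPn.trans (le_add_of_nonneg_right (sq_nonneg _))
    · exact hQn.trans (le_add_of_nonneg_left (sq_nonneg _))
  calc _ ≤ ∫⁻ ω, ENNReal.ofReal (9 * Real.exp (-(wt s * t / 2))) *
        (ENNReal.ofReal (P ω) + ENNReal.ofReal (Q ω)) ∂μ := lintegral_mono hpt
    _ ≤ ENNReal.ofReal (9 * Real.exp (-(wt s * t / 2))) *
        (ENNReal.ofReal (4 ^ d * Real.exp (2 ^ d / 4 * wt s)) +
          ENNReal.ofReal (4 ^ d * Real.exp (2 ^ d / 4 * wt s))) := by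
        rw [lintegral_const_mul' _ _ ENNReal.ofReal_ne_top, lintegral_add_left hPm.ennreal_ofReal,
          ← hexp]
        gcongr
    _ ≤ ENNReal.ofReal (18 * 4 ^ d * Real.exp (-((d + 1 : ℕ) * wt s))) := by
        rw [← ENNReal.ofReal_add (by positivity) (by positivity),
          ← ENNReal.ofReal_mul (by positivity)]
        apply ENNReal.ofReal_le_ofReal
        have : 9 * Real.exp (-(wt s * t / 2)) * (4 ^ d * Real.exp (2 ^ d / 4 * wt s) +
            4 ^ d * Real.exp (2 ^ d / 4 * wt s)) =
            18 * 4 ^ d * Real.exp (-(wt s * t / 2) + 2 ^ d / 4 * wt s) := by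
          rw [Real.exp_add]; ring
        rw [this]
        refine mul_le_mul_of_nonneg_left (Real.exp_le_exp.2 ?_) (by positivity)
        rw [ht]
        push_cast
        have : (0 : ℝ) < 2 ^ d := by positivity
        nlinarith
    _ ≤ _ := by
        rw [ENNReal.ofReal_mul (by positivity)]
        gcongr
        have h1 : Real.exp (-((d + 1 : ℕ) * wt s)) ≤ (((s : ℝ) + 1) ^ (d + 1))⁻¹ := by
          rw [Real.exp_neg, Real.exp_nat_mul, exp_wt]
          gcongr
          have := Real.add_one_le_exp 1
          nlinarith [(Nat.cast_nonneg s : (0 : ℝ) ≤ s)]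
        refine (ENNReal.ofReal_le_ofReal h1).trans_eq ?_
        rw [ENNReal.ofReal_inv_of_pos (by positivity), ENNReal.ofReal_pow (by positivity),
          ENNReal.ofReal_add (by positivity) zero_le_one, ENNReal.ofReal_natCast,
          ENNReal.ofReal_one]

/-- Counting blocks costs `(s + 1) ^ (d - 1)`, so `∑ (s + 1) ^ (-2)` remains. -/
lemma tsum_inv_pow_lt_top {d : ℕ} (hd : 1 ≤ d) :
    ∑' k : Fin d → ℕ, ((((∑ q, k q : ℕ) : ℝ≥0∞) + 1) ^ (d + 1))⁻¹ < ⊤ := by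
  refine (tsum_sum_le hd fun s => (((s : ℝ≥0∞) + 1) ^ (d + 1))⁻¹).trans_lt ?_
  have h : ∀ s : ℕ, ((s : ℝ≥0∞) + 1) ^ (d - 1) * (((s : ℝ≥0∞) + 1) ^ (d + 1))⁻¹ =
      ENNReal.ofReal (1 / ((s + 1 : ℕ) : ℝ) ^ 2) := fun s => by
    have h1 : ((s : ℝ≥0∞) + 1) ^ (d - 1) ≠ 0 := by positivity
    have h2 : ((s : ℝ≥0∞) + 1) ^ (d - 1) ≠ ⊤ := by finiteness
    rw [show d + 1 = (d - 1) + 2 by omega, pow_add, ENNReal.mul_inv (.inl h1) (.inl h2), ← mul_assoc,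
      ENNReal.mul_inv_cancel h1 h2, one_mul, one_div, ENNReal.ofReal_inv_of_pos (by positivity),
      ENNReal.ofReal_pow (by positivity), ENNReal.ofReal_natCast]
    push_cast; rfl
  simp_rw [h]
  have hs : Summable fun s : ℕ => 1 / ((s + 1 : ℕ) : ℝ) ^ 2 :=
    (summable_nat_add_iff 1).2 (Real.summable_one_div_nat_pow.2 (by norm_num))
  exact hs.tsum_ofReal_lt_top

end Bounded

/-! ### Truncation and the maximal inequality for i.i.d. fields -/

/-- The part of `x` not exceeding `b` in absolute value. -/
noncomputable def trunc (b x : ℝ) : ℝ := if |x| ≤ b then x else 0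

/-- The absolute value of the part of `x` exceeding `b`. -/
noncomputable def tail (b x : ℝ) : ℝ≥0∞ := if b < |x| then ENNReal.ofReal |x| else 0

lemma measurable_trunc (b : ℝ) : Measurable (trunc b) :=
  Measurable.ite (measurableSet_le measurable_id.abs measurable_const) measurable_id measurable_const

lemma measurable_tail (b : ℝ) : Measurable (tail b) :=
  Measurable.ite (measurableSet_lt measurable_const measurable_id.abs)
    measurable_id.abs.ennreal_ofReal measurable_const

lemma abs_trunc_le {b : ℝ} (hb : 0 ≤ b) (x : ℝ) : |trunc b x| ≤ b := by
  unfold trunc; split_ifs with h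
  · exact h
  · simpa using hb

lemma trunc_sq_le (b x : ℝ) : trunc b x ^ 2 ≤ x ^ 2 := by
  unfold trunc; split_ifs with h
  · exact le_rfl
  · simpa using sq_nonneg x

lemma ofReal_abs_sub_trunc (b x : ℝ) : ENNReal.ofReal |x - trunc b x| = tail b x := by
  unfold trunc tail
  by_cases h : |x| ≤ b
  · simp [h, not_lt.2 h]
  · simp [h, not_le.1 h]

lemma phi_two {d : ℕ} (hd : 1 ≤ d) (y : ℝ) :
    phi 2 ((d : ℝ) - 1) y = (1 + Real.log (1 + y)) ^ (d - 1) * y ^ 2 := by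
  rw [phi, Real.rpow_two, mul_comm, ← Real.rpow_natCast (1 + Real.log (1 + y)), Nat.cast_sub hd,
    Nat.cast_one]

lemma sq_le_phi {d : ℕ} (hd : 1 ≤ d) {y : ℝ} (hy : 0 ≤ y) : y ^ 2 ≤ phi 2 ((d : ℝ) - 1) y := by
  rw [phi_two hd]
  exact le_mul_of_one_le_left (sq_nonneg y)
    (one_le_pow₀ (by linarith [Real.log_nonneg (by linarith : 1 ≤ 1 + y)]))

/-- The maximal function of a field indexed by `ℕ ^ d`. -/
noncomputable def boxMax {Ω : Type*} {d : ℕ} (Y : (Fin d → ℕ) → Ω → ℝ) (ω : Ω) : ℝ≥0∞ :=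
  ⨆ n : Fin d → ℕ, ENNReal.ofReal
    (|boxSum Y n ω| / Real.sqrt ((∏ q, (n q : ℝ)) * LL (∏ q, (n q : ℝ))))

section Iid

variable {Ω : Type*} [MeasurableSpace Ω] {μ : Measure Ω} [IsProbabilityMeasure μ] {d : ℕ}

lemma integral_sq_le_one (hd : 1 ≤ d) {Z : Ω → ℝ} (hm : Measurable Z)
    (hphi : ∫⁻ ω, ENNReal.ofReal (phi 2 ((d : ℝ) - 1) |Z ω|) ∂μ ≤ 1) :
    Integrable (fun ω => Z ω ^ 2) μ ∧ ∫ ω, Z ω ^ 2 ∂μ ≤ 1 := by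
  have h : ∫⁻ ω, ENNReal.ofReal (Z ω ^ 2) ∂μ ≤ 1 := by
    refine (lintegral_mono fun ω => ENNReal.ofReal_le_ofReal ?_).trans hphi
    rw [← sq_abs]; exact sq_le_phi hd (abs_nonneg _)
  have hi : Integrable (fun ω => Z ω ^ 2) μ :=
    ⟨(hm.pow_const 2).aestronglyMeasurable, by
      rw [hasFiniteIntegral_iff_ofReal (.of_forall fun ω => sq_nonneg _)]
      exact h.trans_lt ENNReal.one_lt_top⟩
  refine ⟨hi, ?_⟩
  rw [← ofReal_integral_eq_lintegral_ofReal hi (.of_forall fun ω => sq_nonneg _)] at h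
  exact ENNReal.ofReal_le_one.1 h

/-- Exchange sum and expectation: at a value `y` the levels below `|y|` contribute `|y| ^ α` times
the logarithmic factor, and `|y| ^ (2 - α)` completes this to the Young function. The case `α = 1`
serves first moments of tails, `α = 2 - p` their `p`-th moments. -/
lemma exists_tsum_lev_mul_tail_le (hd : 1 ≤ d) {α : ℝ} (hα : 0 < α) (hα2 : α < 2) :
    ∃ C : ℝ≥0∞, C ≠ ⊤ ∧ ∀ {Ω : Type*} [MeasurableSpace Ω] (μ : Measure Ω) (Z : Ω → ℝ),
      Measurable Z → ∫⁻ ω, ENNReal.ofReal (phi 2 ((d : ℝ) - 1) |Z ω|) ∂μ ≤ 1 →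
      ∑' k : Fin d → ℕ, ENNReal.ofReal (lev (∑ q, k q) ^ α) *
        ∫⁻ ω, tail (lev (∑ q, k q)) (Z ω) ^ (2 - α) ∂μ ≤ C := by
  obtain ⟨C, hC, h⟩ := tsum_lev_sum_lt_le hd hα
  refine ⟨C, hC, fun μ Z hm hphi => ?_⟩
  have hα' : 0 < 2 - α := by linarith
  have hpt : ∀ y, ∑' k : Fin d → ℕ, ENNReal.ofReal (lev (∑ q, k q) ^ α) *
      tail (lev (∑ q, k q)) y ^ (2 - α) ≤ C * ENNReal.ofReal (phi 2 ((d : ℝ) - 1) |y|) := by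
    intro y
    have h1 : ∀ k : Fin d → ℕ, ENNReal.ofReal (lev (∑ q, k q) ^ α) *
        tail (lev (∑ q, k q)) y ^ (2 - α) =
        (if lev (∑ q, k q) < |y| then ENNReal.ofReal (lev (∑ q, k q) ^ α) else 0) *
          ENNReal.ofReal (|y| ^ (2 - α)) := fun k => by
      unfold tail
      split_ifs with hk
      · rw [ENNReal.ofReal_rpow_of_nonneg (abs_nonneg _) hα'.le]
      · rw [ENNReal.zero_rpow_of_pos hα', mul_zero, zero_mul]
    simp_rw [h1]
    rw [ENNReal.tsum_mul_right]
    refine (mul_le_mul_left (h |y| (abs_nonneg _)) _).trans_eq ?_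
    have hlog := Real.log_nonneg (by linarith [abs_nonneg y] : 1 ≤ 1 + |y|)
    rw [mul_assoc, ← ENNReal.ofReal_mul (by positivity), mul_assoc,
      ← Real.rpow_add_of_nonneg (abs_nonneg _) hα.le hα'.le, phi_two hd]
    norm_num
  calc _ = ∫⁻ ω, ∑' k : Fin d → ℕ, ENNReal.ofReal (lev (∑ q, k q) ^ α) *
        tail (lev (∑ q, k q)) (Z ω) ^ (2 - α) ∂μ := by
        have hmt : ∀ k : Fin d → ℕ, Measurable fun ω => tail (lev (∑ q, k q)) (Z ω) ^ (2 - α) :=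
          fun k => ((measurable_tail _).comp hm).pow_const _
        rw [lintegral_tsum fun k => ((hmt k).const_mul _).aemeasurable]
        exact tsum_congr fun k => (lintegral_const_mul _ (hmt k)).symm
    _ ≤ ∫⁻ ω, C * ENNReal.ofReal (phi 2 ((d : ℝ) - 1) |Z ω|) ∂μ := lintegral_mono fun ω => hpt _
    _ = C * ∫⁻ ω, ENNReal.ofReal (phi 2 ((d : ℝ) - 1) |Z ω|) ∂μ := lintegral_const_mul' _ _ hC
    _ ≤ C := mul_le_of_le_one_right' hphi

lemma ENNReal_tsum_rpow_le {ι : Type*} (x : ι → ℝ≥0∞) {p : ℝ} (hp : 1 ≤ p) :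
    ∑' i, x i ^ p ≤ (∑' i, x i) ^ p := by
  have hmul : ∀ y : ℝ≥0∞, y * y ^ (p - 1) = y ^ p := fun y => by
    nth_rw 1 [← ENNReal.rpow_one y]
    rw [← ENNReal.rpow_add_of_nonneg _ _ zero_le_one (by linarith)]; congr 1; ring
  rw [← hmul, ← ENNReal.tsum_mul_right]
  refine ENNReal.tsum_le_tsum fun i => ?_
  rw [← hmul]
  gcongr
  exact ENNReal.le_tsum i

/-- The box sum over the dyadic block `k` of the tails of the field. -/
noncomputable def tailSum (Y : (Fin d → ℕ) → Ω → ℝ) (k : Fin d → ℕ) (ω : Ω) : ℝ≥0∞ :=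
  ∑ i ∈ Fintype.piFinset fun q => Finset.range (2 ^ (k q + 1)), tail (lev (∑ q, k q)) (Y i ω)

lemma prod_two_pow_succ (k : Fin d → ℕ) : ∏ q, 2 ^ (k q + 1) = 2 ^ d * 2 ^ (∑ q, k q) := by
  simp only [pow_succ]
  rw [Finset.prod_mul_distrib, Finset.prod_pow_eq_pow_sum]
  simp [mul_comm]

/-- The Rosenthal-type bound divided by `psi s ^ p`. The exponents `2 - (2 - p)` and `2 - 1` are
left unsimplified to match the summability lemma for `α = 2 - p` and `α = 1`. -/
lemma lintegral_tailSum_rpow_le {Y : (Fin d → ℕ) → Ω → ℝ} (hm : ∀ i, Measurable (Y i))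
    (hi : iIndepFun Y μ) (hid : ∀ i, IdentDistrib (Y i) (Y 0) μ μ) {p : ℝ} (hp1 : 1 < p)
    (hp2 : p < 2) (k : Fin d → ℕ) :
    ∫⁻ ω, (tailSum Y k ω / ENNReal.ofReal (psi (∑ q, k q))) ^ p ∂μ ≤
      2 ^ d * (ENNReal.ofReal (lev (∑ q, k q) ^ (2 - p)) *
        ∫⁻ ω, tail (lev (∑ q, k q)) (Y 0 ω) ^ (2 - (2 - p)) ∂μ) +
      (2 ^ d * (ENNReal.ofReal (lev (∑ q, k q) ^ (1 : ℝ)) *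
        ∫⁻ ω, tail (lev (∑ q, k q)) (Y 0 ω) ^ (2 - (1 : ℝ)) ∂μ)) ^ p := by
  set s := ∑ q, k q with hs
  have hψ := psi_pos s
  have hp0 : 0 ≤ p := by linarith
  have h21 : (2 : ℝ) - 1 = 1 := by norm_num
  have hindep : iIndepFun (fun i ω => tail (lev s) (Y i ω)) μ :=
    hi.comp (fun _ => tail (lev s)) fun _ => measurable_tail _
  have hmt : ∀ i, Measurable fun ω => tail (lev s) (Y i ω) := fun i =>
    (measurable_tail _).comp (hm i)
  have h := lintegral_sum_rpow_le hmt hindep hp1 hp2.le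
    (Fintype.piFinset fun q => Finset.range (2 ^ (k q + 1)))
  have h1 : ∀ i, ∫⁻ ω, tail (lev s) (Y i ω) ^ p ∂μ = ∫⁻ ω, tail (lev s) (Y 0 ω) ^ p ∂μ := fun i =>
    ((hid i).comp ((measurable_tail (lev s)).pow_const p)).lintegral_eq
  have h2 : ∀ i, ∫⁻ ω, tail (lev s) (Y i ω) ∂μ = ∫⁻ ω, tail (lev s) (Y 0 ω) ∂μ := fun i =>
    ((hid i).comp (measurable_tail (lev s))).lintegral_eq
  simp_rw [h1, h2, Finset.sum_const, card_box, prod_two_pow_succ, ← hs, nsmul_eq_mul] at h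
  rw [sub_sub_cancel, h21]
  simp_rw [ENNReal.rpow_one, Real.rpow_one, ENNReal.div_rpow_of_nonneg _ _ hp0, div_eq_mul_inv]
  have hψp : ENNReal.ofReal (psi s) ^ p = ENNReal.ofReal (psi s ^ p) :=
    ENNReal.ofReal_rpow_of_nonneg hψ.le hp0
  have hinv : (ENNReal.ofReal (psi s) ^ p)⁻¹ ≠ ⊤ := by
    rw [hψp, ENNReal.inv_ne_top]
    exact (ENNReal.ofReal_pos.2 (by positivity)).ne'
  rw [lintegral_mul_const' _ _ hinv]
  have hc1 : (((2 ^ d * 2 ^ s : ℕ) : ℝ≥0∞)) * (ENNReal.ofReal (psi s) ^ p)⁻¹ ≤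
      2 ^ d * ENNReal.ofReal (lev s ^ (2 - p)) := by
    push_cast
    rw [mul_assoc]
    gcongr
    refine le_trans (le_of_eq ?_) (ENNReal.ofReal_le_ofReal (two_pow_div_psi_rpow_le s hp1.le))
    rw [ENNReal.ofReal_div_of_pos (by positivity), hψp, ENNReal.ofReal_pow (by norm_num)]
    simp [div_eq_mul_inv]
  have hc2 : (((2 ^ d * 2 ^ s : ℕ) : ℝ≥0∞)) * (ENNReal.ofReal (psi s))⁻¹ =
      2 ^ d * ENNReal.ofReal (lev s) := by
    push_cast
    rw [mul_assoc, ← two_pow_div_psi s, ENNReal.ofReal_div_of_pos hψ,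
      ENNReal.ofReal_pow (by norm_num)]
    simp [div_eq_mul_inv]
  calc _ ≤ _ := mul_le_mul_left h _
    _ = ((2 ^ d * 2 ^ s : ℕ) : ℝ≥0∞) * (ENNReal.ofReal (psi s) ^ p)⁻¹ *
          ∫⁻ ω, tail (lev s) (Y 0 ω) ^ p ∂μ +
        (((2 ^ d * 2 ^ s : ℕ) : ℝ≥0∞) * (ENNReal.ofReal (psi s))⁻¹ *
          ∫⁻ ω, tail (lev s) (Y 0 ω) ∂μ) ^ p := by
        rw [add_mul, ← ENNReal.inv_rpow, ← ENNReal.mul_rpow_of_nonneg _ _ hp0]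
        congr 1
        · ring
        · congr 1; ring
    _ ≤ _ := by
        rw [hc2, ← mul_assoc, ← mul_assoc]
        gcongr

lemma measurable_tailSum {Y : (Fin d → ℕ) → Ω → ℝ} (hm : ∀ i, Measurable (Y i)) (k : Fin d → ℕ) :
    Measurable (tailSum Y k) :=
  Finset.measurable_fun_sum _ fun i _ => (measurable_tail _).comp (hm i)

/-- The truncated field, centered. -/
noncomputable def centered (μ : Measure Ω) (Y : (Fin d → ℕ) → Ω → ℝ) (b : ℝ) (i : Fin d → ℕ)
    (ω : Ω) : ℝ :=
  trunc b (Y i ω) - ∫ ω, trunc b (Y i ω) ∂μ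

/-- Each variable is its centered truncation plus its tail plus the truncated mean. As the field is
centered, that mean is minus the mean of the discarded part, hence bounded by the first moment of
the tail. -/
lemma ofReal_abs_boxSum_le {Y : (Fin d → ℕ) → Ω → ℝ} (hm : ∀ i, Measurable (Y i))
    (hid : ∀ i, IdentDistrib (Y i) (Y 0) μ μ) (hint : Integrable (Y 0) μ)
    (hc : ∫ ω, Y 0 ω ∂μ = 0) {k n : Fin d → ℕ} (hn : n ≤ fun q => 2 ^ (k q + 1)) (ω : Ω) :
    ENNReal.ofReal |boxSum Y n ω| ≤
      ENNReal.ofReal |boxSum (centered μ Y (lev (∑ q, k q))) n ω| + tailSum Y k ω +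
        2 ^ d * 2 ^ (∑ q, k q) * ∫⁻ ω, tail (lev (∑ q, k q)) (Y 0 ω) ∂μ := by
  set s := ∑ q, k q with hs
  set b := lev s with hb
  have hmean : ∀ i, ENNReal.ofReal |∫ ω, trunc b (Y i ω) ∂μ| ≤ ∫⁻ ω, tail b (Y 0 ω) ∂μ := by
    intro i
    have h1 : ∫ ω, trunc b (Y i ω) ∂μ = ∫ ω, trunc b (Y 0 ω) ∂μ :=
      ((hid i).comp (measurable_trunc b)).integral_eq
    have h2 : Integrable (fun ω => trunc b (Y 0 ω)) μ :=
      integrable_of_bounded ((measurable_trunc b).comp (hm 0))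
        ⟨b, fun ω => abs_trunc_le (lev_pos s).le _⟩
    have h3 : ∫ ω, trunc b (Y 0 ω) ∂μ = -∫ ω, (Y 0 ω - trunc b (Y 0 ω)) ∂μ := by
      rw [integral_sub hint h2, hc]; ring
    rw [h1, h3, abs_neg, ← Real.norm_eq_abs, ofReal_norm]
    refine (enorm_integral_le_lintegral_enorm _).trans_eq (lintegral_congr fun ω => ?_)
    rw [← ofReal_abs_sub_trunc, ← ofReal_norm, Real.norm_eq_abs]
  have hsub : (Fintype.piFinset fun q => Finset.range (n q)) ⊆
      Fintype.piFinset fun q => Finset.range (2 ^ (k q + 1)) :=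
    Fintype.piFinset_subset _ _ fun q => Finset.range_subset_range.2 (hn q)
  have hdecomp : boxSum Y n ω = boxSum (centered μ Y b) n ω +
      ∑ i ∈ Fintype.piFinset fun q => Finset.range (n q), (Y i ω - trunc b (Y i ω)) +
      ∑ i ∈ Fintype.piFinset fun q => Finset.range (n q), ∫ ω, trunc b (Y i ω) ∂μ := by
    unfold boxSum centered
    rw [← Finset.sum_add_distrib, ← Finset.sum_add_distrib]
    exact Finset.sum_congr rfl fun i _ => by ring
  have hofsum : ∀ g : (Fin d → ℕ) → ℝ,
      ENNReal.ofReal |∑ i ∈ Fintype.piFinset fun q => Finset.range (n q), g i| ≤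
        ∑ i ∈ Fintype.piFinset fun q => Finset.range (2 ^ (k q + 1)), ENNReal.ofReal |g i| :=
    fun g => by
      refine (ENNReal.ofReal_le_ofReal (Finset.abs_sum_le_sum_abs _ _)).trans ?_
      rw [ENNReal.ofReal_sum_of_nonneg fun i _ => abs_nonneg _]
      exact Finset.sum_le_sum_of_subset hsub
  rw [hdecomp]
  refine (ENNReal.ofReal_le_ofReal (abs_add_three _ _ _)).trans ?_
  rw [ENNReal.ofReal_add (by positivity) (abs_nonneg _),
    ENNReal.ofReal_add (abs_nonneg _) (abs_nonneg _)]
  gcongr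
  · refine (hofsum _).trans_eq ?_
    simp_rw [ofReal_abs_sub_trunc]
    rfl
  · refine (hofsum _).trans ((Finset.sum_le_sum fun i _ => hmean i).trans_eq ?_)
    rw [Finset.sum_const, card_box, prod_two_pow_succ, nsmul_eq_mul]
    push_cast
    rfl

end Iid

section Iid

variable {Ω : Type*} [MeasurableSpace Ω] {μ : Measure Ω} [IsProbabilityMeasure μ] {d : ℕ}

/-- The excess of the normalized maximum of the centered truncated sums over a dyadic block. -/
noncomputable def excess (μ : Measure Ω) (Y : (Fin d → ℕ) → Ω → ℝ) (p : ℝ) (k : Fin d → ℕ)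
    (ω : Ω) : ℝ≥0∞ :=
  ⨆ n ∈ Finset.Iic (fun q => 2 ^ (k q + 1)),
    ENNReal.ofReal (|boxSum (centered μ Y (lev (∑ q, k q))) n ω| / psi (∑ q, k q) -
      (2 ^ d + 2 * (d + 1))) ^ p

lemma measurable_excess {Y : (Fin d → ℕ) → Ω → ℝ} (hm : ∀ i, Measurable (Y i)) (p : ℝ)
    (k : Fin d → ℕ) : Measurable (excess μ Y p k) := by
  refine .iSup fun n => .iSup fun _ => ?_
  have h : Measurable (boxSum (centered μ Y (lev (∑ q, k q))) n) :=
    measurable_boxSum (fun i => ((measurable_trunc _).comp (hm i)).sub_const _) n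
  fun_prop

lemma ENNReal_add_four_rpow_le (a b c e : ℝ≥0∞) {p : ℝ} (hp : 0 ≤ p) :
    (2 * (a + b + c + e)) ^ p ≤ 8 ^ p * (a ^ p + b ^ p + c ^ p + e ^ p) := by
  set m := max (max a b) (max c e) with hm
  have ha : a ≤ m := le_max_of_le_left (le_max_left _ _)
  have hb : b ≤ m := le_max_of_le_left (le_max_right _ _)
  have hc : c ≤ m := le_max_of_le_right (le_max_left _ _)
  have he : e ≤ m := le_max_of_le_right (le_max_right _ _)
  have h1 : 2 * (a + b + c + e) ≤ 8 * m := by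
    calc _ ≤ 2 * (m + m + m + m) := by gcongr
      _ = 8 * m := by ring
  refine (ENNReal.rpow_le_rpow h1 hp).trans ?_
  rw [ENNReal.mul_rpow_of_nonneg _ _ hp]
  gcongr
  have h2 : m = a ∨ m = b ∨ m = c ∨ m = e := by
    rcases max_choice (max a b) (max c e) with h | h <;> rw [hm, h]
    · rcases max_choice a b with h | h <;> simp [h]
    · rcases max_choice c e with h | h <;> simp [h]
  rcases h2 with h | h | h | h <;> rw [h]
  · rw [add_assoc, add_assoc]; exact le_self_add
  · rw [add_assoc, add_assoc]; exact le_self_add.trans le_add_self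
  · rw [add_assoc, add_assoc]; exact (le_self_add.trans le_add_self).trans le_add_self
  · exact le_add_self

lemma psi_le_two_mul_sqrt {s : ℕ} {x : ℝ} (hx : 2 ^ s ≤ x) :
    psi s ≤ 2 * Real.sqrt (x * LL x) := by
  have h2 : (2 : ℝ) = Real.sqrt 4 := by
    rw [show (4 : ℝ) = 2 ^ 2 by norm_num, Real.sqrt_sq (by norm_num)]
  have hx0 : (0 : ℝ) < 2 ^ s := by positivity
  rw [psi]
  nth_rw 2 [h2]
  rw [← Real.sqrt_mul (by norm_num)]
  apply Real.sqrt_le_sqrt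
  have := mul_le_mul hx (wt_le_LL hx) (wt_pos s).le (hx0.le.trans hx)
  linarith

/-- The maximal function of an i.i.d. field raised to the power `p`, bounded by the
contributions of the dyadic blocks. -/
lemma boxMax_rpow_le {Y : (Fin d → ℕ) → Ω → ℝ} (hm : ∀ i, Measurable (Y i))
    (hid : ∀ i, IdentDistrib (Y i) (Y 0) μ μ) (hint : Integrable (Y 0) μ)
    (hc : ∫ ω, Y 0 ω ∂μ = 0) {p : ℝ} (hp : 1 < p) {C : ℝ≥0∞}
    (hC : ∑' k : Fin d → ℕ, ENNReal.ofReal (lev (∑ q, k q) ^ (1 : ℝ)) *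
        ∫⁻ ω, tail (lev (∑ q, k q)) (Y 0 ω) ^ (2 - (1 : ℝ)) ∂μ ≤ C) (ω : Ω) :
    boxMax Y ω ^ p ≤ 8 ^ p * (ENNReal.ofReal (2 ^ d + 2 * (d + 1)) ^ p +
      ∑' k, excess μ Y p k ω +
      ∑' k, (tailSum Y k ω / ENNReal.ofReal (psi (∑ q, k q))) ^ p + (2 ^ d * C) ^ p) := by
  have hp0 : 0 < p := by linarith
  set R := 8 ^ p * (ENNReal.ofReal (2 ^ d + 2 * (d + 1)) ^ p +
      ∑' k, excess μ Y p k ω +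
      ∑' k, (tailSum Y k ω / ENNReal.ofReal (psi (∑ q, k q))) ^ p + (2 ^ d * C) ^ p) with hR
  rw [← ENNReal.le_rpow_inv_iff hp0]
  refine iSup_le fun n => ?_
  rw [ENNReal.le_rpow_inv_iff hp0]
  by_cases h0 : ∃ q, n q = 0
  · obtain ⟨q, hq⟩ := h0
    rw [boxSum_eq_zero hq]
    simp [hp0]
  push Not at h0
  -- The block of `n`: `2 ^ k q ≤ n q < 2 ^ (k q + 1)`, so `psi s` is at most twice the true
  -- normalization.
  set k : Fin d → ℕ := fun q => Nat.log 2 (n q) with hk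
  set s := ∑ q, k q with hs
  have hnk : n ≤ fun q => 2 ^ (k q + 1) := fun q => (Nat.lt_pow_succ_log_self one_lt_two _).le
  have hvol : (2 : ℝ) ^ s ≤ ∏ q, (n q : ℝ) := by
    rw [hs, ← Finset.prod_pow_eq_pow_sum]
    refine Finset.prod_le_prod (fun _ _ => by positivity) fun q _ => ?_
    exact_mod_cast Nat.pow_log_le_self 2 (h0 q)
  have hψ := psi_pos s
  set v := Real.sqrt ((∏ q, (n q : ℝ)) * LL (∏ q, (n q : ℝ))) with hv
  have hψv : psi s ≤ 2 * v := psi_le_two_mul_sqrt hvol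
  have hψ0 : ENNReal.ofReal (psi s) ≠ 0 := (ENNReal.ofReal_pos.2 hψ).ne'
  have hterm : ENNReal.ofReal (|boxSum Y n ω| / v) ≤
      2 * (ENNReal.ofReal (2 ^ d + 2 * (d + 1)) +
        ENNReal.ofReal (|boxSum (centered μ Y (lev s)) n ω| / psi s - (2 ^ d + 2 * (d + 1))) +
        tailSum Y k ω / ENNReal.ofReal (psi s) + 2 ^ d * C) := by
    have h1 : |boxSum Y n ω| / v ≤ 2 * (|boxSum Y n ω| / psi s) := by
      rw [mul_div_assoc', div_le_div_iff₀ (by linarith) hψ]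
      nlinarith [abs_nonneg (boxSum Y n ω)]
    refine (ENNReal.ofReal_le_ofReal h1).trans ?_
    rw [ENNReal.ofReal_mul (by norm_num), ENNReal.ofReal_ofNat, ENNReal.ofReal_div_of_pos hψ]
    gcongr
    refine (ENNReal.div_le_div_right (ofReal_abs_boxSum_le hm hid hint hc hnk ω) _).trans ?_
    rw [ENNReal.add_div, ENNReal.add_div]
    gcongr ?_ + _ + ?_
    · rw [← ENNReal.ofReal_div_of_pos hψ]
      refine le_trans (ENNReal.ofReal_le_ofReal (le_of_eq ?_)) ENNReal.ofReal_add_le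
      ring
    · rw [← hs, mul_assoc, mul_div_assoc]
      gcongr
      refine le_trans (le_of_eq ?_) ((ENNReal.le_tsum k).trans hC)
      rw [Real.rpow_one, ← hs, ← two_pow_div_psi, ENNReal.ofReal_div_of_pos hψ,
        ENNReal.ofReal_pow (by norm_num), ENNReal.ofReal_ofNat]
      norm_num [div_eq_mul_inv]
      ring
  refine (ENNReal.rpow_le_rpow hterm hp0.le).trans
    ((ENNReal_add_four_rpow_le _ _ _ _ hp0.le).trans ?_)
  rw [hR]
  gcongr 8 ^ p * (_ + ?_ + ?_ + _)
  · refine le_trans ?_ (ENNReal.le_tsum k)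
    exact le_iSup₂_of_le (f := fun n (_ : n ∈ Finset.Iic fun q => 2 ^ (k q + 1)) =>
      ENNReal.ofReal (|boxSum (centered μ Y (lev (∑ q, k q))) n ω| / psi (∑ q, k q) -
      (2 ^ d + 2 * (d + 1))) ^ p) n (Finset.mem_Iic.2 hnk) le_rfl
  · exact ENNReal.le_tsum k

/-- The maximal inequality for i.i.d. fields, normalized. -/
theorem exists_lintegral_boxMax_rpow_le (hd : 1 ≤ d) {p : ℝ} (hp1 : 1 < p) (hp2 : p < 2) :
    ∃ C : ℝ≥0∞, C ≠ ⊤ ∧ ∀ {Ω : Type*} [MeasurableSpace Ω] (μ : Measure Ω) [IsProbabilityMeasure μ]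
      (Y : (Fin d → ℕ) → Ω → ℝ), (∀ i, Measurable (Y i)) → iIndepFun Y μ →
      (∀ i, IdentDistrib (Y i) (Y 0) μ μ) → ∫ ω, Y 0 ω ∂μ = 0 →
      ∫⁻ ω, ENNReal.ofReal (phi 2 ((d : ℝ) - 1) |Y 0 ω|) ∂μ ≤ 1 →
      ∫⁻ ω, boxMax Y ω ^ p ∂μ ≤ C := by
  have hp0 : 0 < p := by linarith
  obtain ⟨A, hA, hA'⟩ := exists_tsum_lev_mul_tail_le hd (α := 1) one_pos (by norm_num)
  obtain ⟨B, hB, hB'⟩ := exists_tsum_lev_mul_tail_le hd (α := 2 - p) (by linarith) (by linarith)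
  have hE := tsum_inv_pow_lt_top hd
  set E := ∑' k : Fin d → ℕ, ((((∑ q, k q : ℕ) : ℝ≥0∞) + 1) ^ (d + 1))⁻¹ with hEdef
  -- In order: the fixed threshold, the excesses over it, the two Rosenthal terms of the tails, and
  -- the truncated means.
  refine ⟨8 ^ p * (ENNReal.ofReal (2 ^ d + 2 * (d + 1)) ^ p + ENNReal.ofReal (18 * 4 ^ d) * E +
    (2 ^ d * B + (2 ^ d * A) ^ p) + (2 ^ d * A) ^ p), ?_, fun μ _ Y hm hi hid hc hphi => ?_⟩
  · have := hE.ne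
    finiteness
  have hA1 := hA' μ (Y 0) (hm 0) hphi
  have hB1 := hB' μ (Y 0) (hm 0) hphi
  obtain ⟨hi2, h2⟩ := integral_sq_le_one hd (hm 0) hphi
  have hint : Integrable (Y 0) μ :=
    ((memLp_two_iff_integrable_sq (hm 0).aestronglyMeasurable).2 hi2).integrable (by norm_num)
  have htsum : ∀ k : Fin d → ℕ,
      Measurable fun ω => (tailSum Y k ω / ENNReal.ofReal (psi (∑ q, k q))) ^ p := fun k =>
    ((measurable_tailSum hm k).div_const _).pow_const _
  refine (lintegral_mono fun ω => boxMax_rpow_le hm hid hint hc hp1 hA1 ω).trans ?_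
  rw [lintegral_const_mul' _ _ (by finiteness), lintegral_add_right _ measurable_const,
    lintegral_add_right _ (Measurable.tsum htsum),
    lintegral_add_left measurable_const, lintegral_const, lintegral_const, measure_univ, mul_one,
    mul_one, lintegral_tsum fun k => (measurable_excess hm p k).aemeasurable,
    lintegral_tsum fun k => (htsum k).aemeasurable]
  gcongr 8 ^ p * (_ + ?_ + ?_ + _)
  · rw [hEdef, ← ENNReal.tsum_mul_left]
    refine ENNReal.tsum_le_tsum fun k => ?_
    set b := lev (∑ q, k q) with hb
    have htm : ∀ i, Measurable fun ω => trunc b (Y i ω) := fun i =>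
      (measurable_trunc b).comp (hm i)
    refine lintegral_iSup_excess_le (Z := fun i ω => trunc b (Y i ω)) htm
      (hi.comp (fun _ => trunc b) fun _ => measurable_trunc b)
      (fun i ω => abs_trunc_le (lev_pos _).le _) (fun i => ?_) hp1.le hp2.le
    have h3 : ∫ ω, trunc b (Y i ω) ^ 2 ∂μ = ∫ ω, trunc b (Y 0 ω) ^ 2 ∂μ :=
      ((hid i).comp ((measurable_trunc b).pow_const 2)).integral_eq
    rw [h3]
    exact (integral_mono_of_nonneg (.of_forall fun ω => sq_nonneg _) hi2
      (.of_forall fun ω => trunc_sq_le _ _)).trans h2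
  · refine (ENNReal.tsum_le_tsum fun k =>
      lintegral_tailSum_rpow_le hm hi hid hp1 hp2 k).trans ?_
    rw [ENNReal.tsum_add, ENNReal.tsum_mul_left]
    gcongr
    refine (ENNReal_tsum_rpow_le _ hp1.le).trans ?_
    rw [ENNReal.tsum_mul_left]
    gcongr

end Iid

/-! ### Norms of functions with values in `[0, ∞]` -/

section Norms

variable {Ω : Type*} [MeasurableSpace Ω] {μ : Measure Ω} {d : ℕ}

lemma eLpNorm_ofReal {p : ℝ} (hp : 0 < p) (g : Ω → ℝ≥0∞) :
    eLpNorm g (ENNReal.ofReal p) μ = (∫⁻ ω, g ω ^ p ∂μ) ^ (1 / p) := by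
  rw [eLpNorm_eq_lintegral_rpow_enorm_toReal (ENNReal.ofReal_pos.2 hp).ne' ENNReal.ofReal_ne_top,
    ENNReal.toReal_ofReal hp.le]
  simp

lemma eLpNorm_const_mul_ennreal {p : ℝ} (hp : 0 < p) {c : ℝ≥0∞} (hc : c ≠ ⊤) (g : Ω → ℝ≥0∞) :
    eLpNorm (fun ω => c * g ω) (ENNReal.ofReal p) μ = c * eLpNorm g (ENNReal.ofReal p) μ := by
  rw [eLpNorm_ofReal hp, eLpNorm_ofReal hp]
  simp_rw [ENNReal.mul_rpow_of_nonneg _ _ hp.le]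
  rw [lintegral_const_mul' _ _ (by finiteness), ENNReal.mul_rpow_of_nonneg _ _ (by positivity),
    ← ENNReal.rpow_mul, mul_one_div_cancel hp.ne', ENNReal.rpow_one]

/-- Minkowski's inequality for finite sums, passed to the limit by monotone convergence. -/
lemma eLpNorm_tsum_le {p : ℝ} (hp : 1 ≤ p) {g : ℕ → Ω → ℝ≥0∞} (hg : ∀ j, Measurable (g j)) :
    eLpNorm (fun ω => ∑' j, g j ω) (ENNReal.ofReal p) μ ≤
      ∑' j, eLpNorm (g j) (ENNReal.ofReal p) μ := by
  have hp0 : 0 < p := by linarith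
  have hmono : ∀ ω, Monotone fun J : ℕ => ∑ j ∈ Finset.range J, g j ω := fun ω =>
    monotone_nat_of_le_succ fun J => by rw [Finset.sum_range_succ]; exact le_self_add
  rw [eLpNorm_ofReal hp0, one_div, ENNReal.rpow_inv_le_iff hp0]
  have h1 : ∀ ω, (∑' j, g j ω) ^ p = ⨆ J : ℕ, (∑ j ∈ Finset.range J, g j ω) ^ p := fun ω => by
    rw [ENNReal.tsum_eq_iSup_nat]
    exact (ENNReal.orderIsoRpow p hp0).map_iSup _
  simp_rw [h1]
  rw [lintegral_iSup (fun J => (Finset.measurable_fun_sum _ fun j _ => hg j).pow_const _)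
    fun J J' h ω => ENNReal.rpow_le_rpow (hmono ω h) hp0.le]
  refine iSup_le fun J => ?_
  rw [← ENNReal.rpow_inv_le_iff hp0, ← one_div, ← eLpNorm_ofReal hp0]
  refine le_trans ?_ ((eLpNorm_sum_le (f := g) (s := Finset.range J)
    (fun j _ => (hg j).aestronglyMeasurable)
    (ENNReal.one_le_ofReal.2 hp)).trans (ENNReal.sum_le_tsum _))
  refine (le_of_eq ?_)
  congr 1
  ext ω
  simp

lemma orliczNorm_congr {Ω' : Type*} [MeasurableSpace Ω'] {μ' : Measure Ω'} {Y : Ω → ℝ}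
    {Z : Ω' → ℝ} (h : IdentDistrib Y Z μ μ') (p r : ℝ) :
    orliczNorm μ p r Y = orliczNorm μ' p r Z := by
  unfold orliczNorm
  have h1 : ∀ l : ℝ, ∫⁻ ω, ENNReal.ofReal (phi p r (|Y ω| / l)) ∂μ =
      ∫⁻ ω, ENNReal.ofReal (phi p r (|Z ω| / l)) ∂μ' := fun l => by
    have hm : Measurable fun x : ℝ => ENNReal.ofReal (phi p r (|x| / l)) := by
      unfold phi; fun_prop
    exact (h.comp hm).lintegral_eq
  simp_rw [h1]

lemma boxMax_eq_mul (Y : (Fin d → ℕ) → Ω → ℝ) {l : ℝ} (hl : 0 < l) (ω : Ω) :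
    boxMax Y ω = ENNReal.ofReal l * boxMax (fun i ω => Y i ω / l) ω := by
  unfold boxMax
  rw [ENNReal.mul_iSup]
  congr 1
  ext n
  rw [← ENNReal.ofReal_mul hl.le]
  congr 1
  have h : boxSum (fun i ω => Y i ω / l) n ω = boxSum Y n ω / l := (Finset.sum_div _ _ _).symm
  rw [h, abs_div, abs_of_pos hl]
  field_simp

lemma measurable_boxMax {Y : (Fin d → ℕ) → Ω → ℝ} (hm : ∀ i, Measurable (Y i)) :
    Measurable (boxMax Y) :=
  .iSup fun n => (((measurable_boxSum hm n).abs).div_const _).ennreal_ofReal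

end Norms

/-- The maximal inequality for i.i.d. fields. -/
theorem exists_eLpNorm_boxMax_le {d : ℕ} (hd : 1 ≤ d) {p : ℝ} (hp1 : 1 < p) (hp2 : p < 2) :
    ∃ C : ℝ≥0∞, C ≠ ⊤ ∧ ∀ {Ω : Type*} [MeasurableSpace Ω] (μ : Measure Ω) [IsProbabilityMeasure μ]
      (Y : (Fin d → ℕ) → Ω → ℝ), (∀ i, Measurable (Y i)) → iIndepFun Y μ →
      (∀ i, IdentDistrib (Y i) (Y 0) μ μ) → ∫ ω, Y 0 ω ∂μ = 0 →
      eLpNorm (boxMax Y) (ENNReal.ofReal p) μ ≤ C * orliczNorm μ 2 ((d : ℝ) - 1) (Y 0) := by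
  obtain ⟨C, hC, h⟩ := exists_lintegral_boxMax_rpow_le hd hp1 hp2
  have hp0 : 0 < p := by linarith
  -- Adding 1 makes the constant nonzero, so it can be divided out; the claim then becomes a lower
  -- bound for the infimum, checked at each admissible `l` by scaling.
  refine ⟨(C + 1) ^ (1 / p), by finiteness, fun μ _ Y hm hi hid hc => ?_⟩
  have hC0 : (C + 1) ^ (1 / p) ≠ 0 := by positivity
  have hC1 : (C + 1) ^ (1 / p) ≠ ⊤ := by finiteness
  rw [mul_comm, ← ENNReal.div_le_iff hC0 hC1]
  refine le_iInf fun l => le_iInf fun hl => le_iInf fun hphi => ?_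
  rw [ENNReal.div_le_iff hC0 hC1]
  have hbm : boxMax Y = fun ω => ENNReal.ofReal l * boxMax (fun i ω => Y i ω / l) ω :=
    funext fun ω => boxMax_eq_mul Y hl ω
  rw [hbm, eLpNorm_const_mul_ennreal hp0 ENNReal.ofReal_ne_top]
  gcongr
  rw [eLpNorm_ofReal hp0]
  gcongr
  refine (h μ (fun i ω => Y i ω / l) (fun i => (hm i).div_const l)
    (hi.comp (fun _ x => x / l) fun _ => measurable_id.div_const l)
    (fun i => (hid i).comp (u := fun x => x / l) (measurable_id.div_const l)) ?_ ?_).trans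
    le_self_add
  · rw [integral_div, hc, zero_div]
  · simpa only [abs_div, abs_of_pos hl] using hphi

/-! ### Independence of groups and splitting into residue classes -/

/-- Grouping the members of an independent family preserves independence. -/
lemma iIndepFun.curry {Ω ι κ β : Type*} [MeasurableSpace Ω] {μ : Measure Ω} [MeasurableSpace β]
    {X : ι → κ → Ω → β} (hm : ∀ i j, Measurable (X i j))
    (h : iIndepFun (fun (q : ι × κ) ω => X q.1 q.2 ω) μ) :
    iIndepFun (fun i ω j => X i j ω) μ := by
  have := h.isProbabilityMeasure
  have : ∀ i j, IsProbabilityMeasure (μ.map (X i j)) := fun i j =>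
    Measure.isProbabilityMeasure_map (hm i j).aemeasurable
  have hi : ∀ i, iIndepFun (fun j ω => X i j ω) μ := fun i =>
    h.precomp (g := fun j => (i, j)) fun a b hab => (Prod.ext_iff.1 hab).2
  rw [iIndepFun_iff_map_fun_eq_infinitePi_map (by fun_prop)]
  have h1 := h.map_fun_eq_infinitePi_map (fun q : ι × κ => hm q.1 q.2)
  have h2 : (fun ω i j => X i j ω) =
      MeasurableEquiv.curry ι κ β ∘ fun ω (q : ι × κ) => X q.1 q.2 ω := rfl
  rw [h2, ← Measure.map_map (by fun_prop) (by fun_prop), h1,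
    Measure.infinitePi_map_curry (fun i j => μ.map (X i j))]
  congr 1
  ext1 i
  exact ((hi i).map_fun_eq_infinitePi_map (hm i)).symm

section Blocks

variable {Ω : Type*} {d : ℕ}

/-- The subfield of `X` along the residue class of `1 + a` modulo `K`. -/
def residueField (X : (Fin d → ℤ) → Ω → ℝ) (K : ℕ) (a m : Fin d → ℕ) : Ω → ℝ :=
  X fun q => 1 + a q + K * m q

/-- The number of integers in `[1, n]` congruent to `1 + a` modulo `K`, for `a < K`. -/
def residueCount (K n a : ℕ) : ℕ := (n + K - 1 - a) / K

lemma lt_residueCount_iff {K n a m : ℕ} (ha : a < K) :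
    m < residueCount K n a ↔ 1 + a + K * m ≤ n := by
  rw [residueCount, Nat.lt_iff_add_one_le, Nat.le_div_iff_mul_le (by omega), add_mul, one_mul,
    mul_comm m K]
  omega

/-- A class with `c ≥ 1` points in `[1, n]` has last point `1 + a + K * (c - 1) ≤ n`, and `1 + a ≤
K`. The bound is uniform in `n`, including `n < K`. -/
lemma residueCount_mul_le {K n a : ℕ} (ha : a < K) : residueCount K n a * (1 + a) ≤ n := by
  rcases Nat.eq_zero_or_pos (residueCount K n a) with h | h
  · simp [h]
  · have h1 := (lt_residueCount_iff (n := n) ha).1 (Nat.sub_lt h one_pos)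
    obtain ⟨c, hc⟩ : ∃ c, residueCount K n a = c + 1 := ⟨_, (Nat.sub_add_cancel h).symm⟩
    rw [hc] at h1 ⊢
    rw [Nat.add_sub_cancel] at h1
    nlinarith

lemma partialSum_eq_sum_boxSum (X : (Fin d → ℤ) → Ω → ℝ) {K : ℕ} (hK : 0 < K) (n : Fin d → ℕ+)
    (ω : Ω) :
    partialSum X n ω = ∑ a ∈ Fintype.piFinset fun _ : Fin d => Finset.range K,
      boxSum (residueField X K a) (fun q => residueCount K (n q) (a q)) ω := by
  unfold partialSum boxSum
  rw [Finset.sum_sigma']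
  symm
  refine Finset.sum_bij'
    (i := fun x _ => (fun q => 1 + (x.1 q : ℤ) + K * (x.2 q : ℤ) : Fin d → ℤ))
    (j := fun i _ => ⟨fun q => (i q - 1).toNat % K, fun q => (i q - 1).toNat / K⟩) ?_ ?_ ?_ ?_ ?_
  · rintro ⟨a, m⟩ h
    simp only [Finset.mem_sigma, Fintype.mem_piFinset, Finset.mem_range] at h
    rw [Finset.mem_Icc]
    refine ⟨fun q => ?_, fun q => ?_⟩
    · have : (0 : ℤ) ≤ K * m q := by positivity
      simp only [Pi.one_apply]; omega
    · have h1 : ((1 + a q + K * m q : ℕ) : ℤ) ≤ ((n q : ℕ) : ℤ) :=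
        Int.ofNat_le.2 ((lt_residueCount_iff (h.1 q)).1 (h.2 q))
      push_cast at h1
      exact h1
  · intro i h
    rw [Finset.mem_Icc] at h
    simp only [Finset.mem_sigma, Fintype.mem_piFinset, Finset.mem_range]
    refine ⟨fun q => Nat.mod_lt _ hK, fun q => ?_⟩
    rw [lt_residueCount_iff (Nat.mod_lt _ hK), add_assoc, Nat.mod_add_div]
    have h1 := h.1 q
    have h2 := h.2 q
    simp only [Pi.one_apply] at h1 h2
    omega
  · rintro ⟨a, m⟩ h
    simp only [Finset.mem_sigma, Fintype.mem_piFinset, Finset.mem_range] at h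
    have h1 : ∀ q, (1 + (a q : ℤ) + K * (m q : ℤ) - 1).toNat = a q + K * m q := fun q => by
      have : 1 + (a q : ℤ) + K * (m q : ℤ) - 1 = ((a q + K * m q : ℕ) : ℤ) := by push_cast; ring
      rw [this, Int.toNat_natCast]
    simp only [h1]
    congr 1
    · ext q; rw [Nat.add_mul_mod_self_left, Nat.mod_eq_of_lt (h.1 q)]
    · ext q; rw [Nat.add_mul_div_left _ _ hK, Nat.div_eq_of_lt (h.1 q), zero_add]
  · intro i h
    rw [Finset.mem_Icc] at h
    ext q
    have h1 := h.1 q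
    simp only [Pi.one_apply] at h1
    have h2 := Nat.mod_add_div (i q - 1).toNat K
    have h3 : (((i q - 1).toNat % K : ℕ) : ℤ) + K * (((i q - 1).toNat / K : ℕ) : ℤ) =
        ((i q - 1).toNat : ℤ) := by exact_mod_cast h2
    simp only
    omega
  · rintro ⟨a, m⟩ _
    rfl

/-- The weight `∏ 1 / √(1 + a q)` of a residue class. -/
noncomputable def residueWeight (a : Fin d → ℕ) : ℝ := ∏ q, 1 / Real.sqrt (1 + a q)

/-- The sum factorizes over coordinates, and `1 / √(1 + x) ≤ 2√(1 + x) - 2√x` telescopes. -/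
lemma sum_residueWeight_le (K : ℕ) :
    ∑ a ∈ Fintype.piFinset fun _ : Fin d => Finset.range K, residueWeight a ≤
      (2 * Real.sqrt K) ^ d := by
  unfold residueWeight
  rw [← Finset.prod_univ_sum (fun _ => Finset.range K) fun _ x => 1 / Real.sqrt (1 + (x : ℝ)),
    Finset.prod_const, Finset.card_univ, Fintype.card_fin]
  refine pow_le_pow_left₀ (Finset.sum_nonneg fun _ _ => by positivity) ?_ d
  induction K with
  | zero => simp
  | succ K ih =>
    rw [Finset.sum_range_succ]
    have h1 : 0 < Real.sqrt (1 + K) := by positivity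
    have h2 : Real.sqrt (1 + K) ^ 2 = 1 + K := Real.sq_sqrt (by positivity)
    have h3 : Real.sqrt K ^ 2 = K := Real.sq_sqrt (by positivity)
    have h4 : 1 / Real.sqrt (1 + K) ≤ 2 * Real.sqrt (1 + K) - 2 * Real.sqrt K := by
      rw [div_le_iff₀ h1]
      nlinarith [sq_nonneg (Real.sqrt (1 + K) - Real.sqrt K)]
    push_cast
    rw [add_comm (K : ℝ) 1]
    linarith

/-- The part of a box in class `a` has volume at most `vol n / ∏ (1 + a q)`; with `LL` monotone,
changing the normalization from the whole box to the class gains the weight. -/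
lemma maximalFunction_le_sum_boxMax (X : (Fin d → ℤ) → Ω → ℝ) {K : ℕ} (hK : 0 < K) (ω : Ω) :
    maximalFunction X ω ≤ ∑ a ∈ Fintype.piFinset fun _ : Fin d => Finset.range K,
      ENNReal.ofReal (residueWeight a) * boxMax (residueField X K a) ω := by
  refine iSup_le fun n => ?_
  rw [partialSum_eq_sum_boxSum X hK]
  set D := Real.sqrt (vol n * LL (vol n)) with hD
  have h0 : 0 ≤ D := Real.sqrt_nonneg _
  refine (ENNReal.ofReal_le_ofReal
    (div_le_div_of_nonneg_right (Finset.abs_sum_le_sum_abs _ _) h0)).trans ?_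
  rw [Finset.sum_div, ENNReal.ofReal_sum_of_nonneg fun a _ => by positivity]
  refine Finset.sum_le_sum fun a ha => ?_
  have ha' : ∀ q, a q < K := fun q => Finset.mem_range.1 (Fintype.mem_piFinset.1 ha q)
  set c : Fin d → ℕ := fun q => residueCount K (n q) (a q) with hc
  by_cases hq : ∃ q, c q = 0
  · obtain ⟨q, hq⟩ := hq
    rw [boxSum_eq_zero hq]
    simp
  push Not at hq
  refine le_trans ?_ (mul_le_mul_right (le_iSup _ c) _)
  have hw0 : 0 ≤ residueWeight a := Finset.prod_nonneg fun _ _ => by positivity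
  rw [← ENNReal.ofReal_mul hw0]
  apply ENNReal.ofReal_le_ofReal
  set v : ℝ := ∏ q, (c q : ℝ) with hv
  have hv1 : 0 < v := Finset.prod_pos fun q _ => by exact_mod_cast Nat.pos_of_ne_zero (hq q)
  set w : ℝ := ∏ q, (1 + (a q : ℝ)) with hw
  have hw1 : 1 ≤ w := by
    have := Finset.prod_le_prod (s := Finset.univ) (f := fun _ : Fin d => (1 : ℝ))
      (g := fun q => 1 + (a q : ℝ)) (fun _ _ => zero_le_one) fun q _ => by
        linarith [(Nat.cast_nonneg (a q) : (0 : ℝ) ≤ a q)]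
    simpa using this
  have hwt : residueWeight a = 1 / Real.sqrt w := by
    rw [residueWeight, hw, Real.sqrt_eq_rpow, ← Real.finsetProd_rpow _ _ fun q _ => by positivity,
      Finset.prod_div_distrib, Finset.prod_const_one]
    simp_rw [Real.sqrt_eq_rpow]
  have hvol : v * w ≤ vol n := by
    rw [hv, hw, ← Finset.prod_mul_distrib, vol]
    refine Finset.prod_le_prod (fun _ _ => by positivity) fun q _ => ?_
    exact_mod_cast residueCount_mul_le (n := n q) (ha' q)
  have hvv : v ≤ vol n := le_trans (by nlinarith) hvol
  have hLL := LL_mono hv1 hvv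
  have hLv := one_le_LL v
  have hden : Real.sqrt w * Real.sqrt (v * LL v) ≤ D := by
    rw [← Real.sqrt_mul (by linarith)]
    apply Real.sqrt_le_sqrt
    calc w * (v * LL v) = (v * w) * LL v := by ring
      _ ≤ vol n * LL (vol n) := mul_le_mul hvol hLL (by linarith) (hv1.le.trans hvv)
  rw [hwt, div_mul_div_comm, one_mul]
  refine div_le_div_of_nonneg_left (abs_nonneg _) ?_ hden
  have : 0 < v * LL v := by nlinarith
  have : 0 < w := by linarith
  positivity

end Blocks

/-! ### Fields depending on finitely many coordinates -/

section Local

variable {Ω : Type*} [MeasurableSpace Ω] {μ : Measure Ω} [IsProbabilityMeasure μ] {d : ℕ}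

lemma measurable_partialSum {X : (Fin d → ℤ) → Ω → ℝ} (hm : ∀ i, Measurable (X i))
    (n : Fin d → ℕ+) : Measurable (partialSum X n) :=
  Finset.measurable_fun_sum _ fun i _ => hm i

lemma measurable_maximalFunction {X : (Fin d → ℤ) → Ω → ℝ} (hm : ∀ i, Measurable (X i)) :
    Measurable (maximalFunction X) :=
  .iSup fun n => ((measurable_partialSum hm n).abs.div_const _).ennreal_ofReal

/-- The family `ε` shifted by `i`. -/
def shiftFamily (ε : (Fin d → ℤ) → Ω → ℝ) (i : Fin d → ℤ) (ω : Ω) : (Fin d → ℤ) → ℝ :=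
  fun u => ε (i + u) ω

lemma identDistrib_shiftFamily {ε : (Fin d → ℤ) → Ω → ℝ}
    (hi : iIndepFun ε μ) (hid : ∀ u, IdentDistrib (ε u) (ε 0) μ μ) (i i' : Fin d → ℤ) :
    IdentDistrib (shiftFamily ε i) (shiftFamily ε i') μ μ :=
  IdentDistrib.pi (X := fun u => ε (i + u)) (Y := fun u => ε (i' + u))
    (fun _ => (hid _).trans (hid _).symm) (hi.precomp (add_right_injective i))
    (hi.precomp (add_right_injective i'))

/-- The field obtained by applying `h` to the coordinates of the shifted families in the ball
of radius `j`. -/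
def localField (ε : (Fin d → ℤ) → Ω → ℝ) (j : ℕ)
    (h : ({u : Fin d → ℤ // ‖u‖ ≤ (j : ℝ)} → ℝ) → ℝ) (i : Fin d → ℤ) (ω : Ω) : ℝ :=
  h fun u => shiftFamily ε i ω u

lemma measurable_localField {ε : (Fin d → ℤ) → Ω → ℝ} (hm : ∀ u, Measurable (ε u)) {j : ℕ}
    {h : ({u : Fin d → ℤ // ‖u‖ ≤ (j : ℝ)} → ℝ) → ℝ} (hh : Measurable h) (i : Fin d → ℤ) :
    Measurable (localField ε j h i) :=
  hh.comp (measurable_pi_lambda _ fun _ => hm _)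

/-- Balls of radius `j` around distinct points of one residue class modulo `2j+1` are disjoint:
coordinates of `u' - u` are at most `2j` in absolute value, so divisibility by `2j+1` forces them to
vanish. -/
lemma residue_add_injective (j : ℕ) (a : Fin d → ℕ) :
    Function.Injective fun x : (Fin d → ℕ) × {u : Fin d → ℤ // ‖u‖ ≤ (j : ℝ)} =>
      (fun q => 1 + (a q : ℤ) + ((2 * j + 1 : ℕ) : ℤ) * (x.1 q : ℤ) : Fin d → ℤ) + x.2.1 := by
  rintro ⟨m, u, hu⟩ ⟨m', u', hu'⟩ h
  have hb : ∀ v : Fin d → ℤ, ‖v‖ ≤ (j : ℝ) → ∀ q, |v q| ≤ (j : ℤ) := fun v hv q => by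
    have := (norm_le_pi_norm v q).trans hv
    rw [Int.norm_eq_abs] at this
    exact_mod_cast this
  have hq : ∀ q, m q = m' q := fun q => by
    have h1 := congrFun h q
    simp only [Pi.add_apply] at h1
    have h2 := abs_le.1 (hb u hu q)
    have h3 := abs_le.1 (hb u' hu' q)
    have h4 : ((2 * j + 1 : ℕ) : ℤ) * ((m q : ℤ) - m' q) = u' q - u q := by linarith
    have h5 : |u' q - u q| < ((2 * j + 1 : ℕ) : ℤ) := by
      rw [abs_lt]; push_cast; constructor <;> linarith
    have h6 := Int.eq_zero_of_abs_lt_dvd (Dvd.intro _ h4) h5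
    rw [h6] at h4
    have h7 : ((2 * j + 1 : ℕ) : ℤ) ≠ 0 := by positivity
    have := (mul_eq_zero.1 h4).resolve_left h7
    omega
  obtain rfl : m = m' := funext hq
  have : u = u' := by simpa using h
  simp [this]

/-- Along a residue class modulo `2j+1` the field uses disjoint groups of the `ε u`, hence is
i.i.d., and `hC` applies to each class. -/
lemma eLpNorm_maximalFunction_localField_le {C : ℝ≥0∞} {p : ℝ} (hp : 1 ≤ p)
    (hC : ∀ Y : (Fin d → ℕ) → Ω → ℝ, (∀ i, Measurable (Y i)) → iIndepFun Y μ →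
      (∀ i, IdentDistrib (Y i) (Y 0) μ μ) → ∫ ω, Y 0 ω ∂μ = 0 →
      eLpNorm (boxMax Y) (ENNReal.ofReal p) μ ≤ C * orliczNorm μ 2 ((d : ℝ) - 1) (Y 0))
    {ε : (Fin d → ℤ) → Ω → ℝ} (hm : ∀ u, Measurable (ε u)) (hi : iIndepFun ε μ)
    (hid : ∀ u, IdentDistrib (ε u) (ε 0) μ μ) {j : ℕ}
    {h : ({u : Fin d → ℤ // ‖u‖ ≤ (j : ℝ)} → ℝ) → ℝ} (hh : Measurable h)
    (hc : ∫ ω, localField ε j h 0 ω ∂μ = 0) :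
    eLpNorm (maximalFunction (localField ε j h)) (ENNReal.ofReal p) μ ≤
      ENNReal.ofReal ((2 * Real.sqrt (2 * j + 1)) ^ d) *
        (C * orliczNorm μ 2 ((d : ℝ) - 1) (localField ε j h 0)) := by
  have hp0 : 0 < p := by linarith
  set X := localField ε j h with hX
  set K := 2 * j + 1 with hK
  have hXm : ∀ i, Measurable (X i) := fun i => measurable_localField hm hh i
  have hG : Measurable fun e : (Fin d → ℤ) → ℝ =>
      h fun u : {u : Fin d → ℤ // ‖u‖ ≤ (j : ℝ)} => e u.1 :=
    hh.comp (measurable_pi_lambda _ fun _ => measurable_pi_apply _)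
  have hXid : ∀ i i', IdentDistrib (X i) (X i') μ μ := fun i i' =>
    (identDistrib_shiftFamily hi hid i i').comp hG
  have hres : ∀ a : Fin d → ℕ, eLpNorm (boxMax (residueField X K a)) (ENNReal.ofReal p) μ ≤
      C * orliczNorm μ 2 ((d : ℝ) - 1) (X 0) := fun a => by
    rw [← orliczNorm_congr (hXid (fun q => 1 + (a q : ℤ) + K * ((0 : Fin d → ℕ) q : ℤ)) 0)]
    refine hC (residueField X K a) (fun m => hXm _) ?_ (fun m => hXid _ _) ?_
    · have h1 := hi.precomp (residue_add_injective j a)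
      have h2 := iIndepFun.curry (X := fun (m : Fin d → ℕ)
        (u : {u : Fin d → ℤ // ‖u‖ ≤ (j : ℝ)}) =>
          ε ((fun q => 1 + (a q : ℤ) + (K : ℤ) * (m q : ℤ) : Fin d → ℤ) + u.1))
        (fun _ _ => hm _) h1
      exact h2.comp (fun _ => h) fun _ => hh
    · exact (hXid _ 0).integral_eq.trans hc
  have hmono : eLpNorm (maximalFunction X) (ENNReal.ofReal p) μ ≤
      eLpNorm (∑ a ∈ Fintype.piFinset fun _ : Fin d => Finset.range K,
        fun ω => ENNReal.ofReal (residueWeight a) * boxMax (residueField X K a) ω)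
        (ENNReal.ofReal p) μ := by
    refine eLpNorm_mono_enorm fun ω => ?_
    simpa using maximalFunction_le_sum_boxMax X (K := K) (by omega) ω
  refine hmono.trans ((eLpNorm_sum_le (fun a _ => ?_) (ENNReal.one_le_ofReal.2 hp)).trans ?_)
  · exact ((measurable_boxMax fun m => hXm _).const_mul _).aestronglyMeasurable
  simp_rw [eLpNorm_const_mul_ennreal hp0 ENNReal.ofReal_ne_top]
  refine (Finset.sum_le_sum fun a _ => mul_le_mul_right (hres a) _).trans ?_
  have hw0 : ∀ a : Fin d → ℕ, 0 ≤ residueWeight a := fun a =>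
    Finset.prod_nonneg fun _ _ => by positivity
  rw [← Finset.sum_mul, ← ENNReal.ofReal_sum_of_nonneg fun a _ => hw0 a]
  gcongr
  refine (sum_residueWeight_le K).trans_eq ?_
  rw [hK]
  push_cast
  rfl

end Local

/-! ### Martingale increments over growing balls -/

section Increments

variable {Ω : Type*} [MeasurableSpace Ω] {μ : Measure Ω} [IsProbabilityMeasure μ] {d : ℕ}
  {ε : (Fin d → ℤ) → Ω → ℝ}

lemma sigmaBall_eq_comap (ε : (Fin d → ℤ) → Ω → ℝ) (j : ℕ) :
    sigmaBall ε j = MeasurableSpace.comap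
      (fun ω (u : {u : Fin d → ℤ // ‖u‖ ≤ (j : ℝ)}) => ε u ω) MeasurableSpace.pi := by
  simp only [sigmaBall, MeasurableSpace.pi, MeasurableSpace.comap_iSup, MeasurableSpace.comap_comp]
  rfl

/-- The filtration of the σ-algebras generated by growing balls. -/
def ballFiltration (ε : (Fin d → ℤ) → Ω → ℝ) (hm : ∀ u, Measurable (ε u)) :
    Filtration ℕ ‹MeasurableSpace Ω› where
  seq j := sigmaBall ε j
  mono' j j' hj := iSup_le fun u => le_iSup_of_le
    (f := fun u : {u : Fin d → ℤ // ‖u‖ ≤ (j' : ℝ)} => MeasurableSpace.comap (ε u) inferInstance)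
    ⟨u.1, u.2.trans (by exact_mod_cast hj)⟩ le_rfl
  le' _ := iSup_le fun u => (hm u).comap_le

lemma sum_increment (Y : Ω → ℝ) (J : ℕ) :
    ∑ j ∈ Finset.range (J + 1), increment μ ε Y j = μ[Y | sigmaBall ε J] := by
  induction J with
  | zero => simp [increment]
  | succ J ih => rw [Finset.sum_range_succ, ih, increment]; abel

lemma integral_increment (hm : ∀ u, Measurable (ε u)) {Y : Ω → ℝ} (hc : ∫ ω, Y ω ∂μ = 0) (j : ℕ) :
    ∫ ω, increment μ ε Y j ω ∂μ = 0 := by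
  have h : ∀ J, ∫ ω, (μ[Y | sigmaBall ε J]) ω ∂μ = 0 := fun J => by
    have hle : sigmaBall ε J ≤ ‹MeasurableSpace Ω› := (ballFiltration ε hm).le J
    rw [integral_condExp hle, hc]
  cases j with
  | zero => exact h 0
  | succ j =>
    simp only [increment, Pi.sub_apply]
    rw [integral_sub integrable_condExp integrable_condExp, h, h, sub_zero]

/-- Doob–Dynkin factorization. Having the increment as a fixed function of the ball coordinates
allows it to be shifted to every site. -/
lemma exists_increment_eq (hm : ∀ u, Measurable (ε u)) (Y : Ω → ℝ) (j : ℕ) :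
    ∃ h : ({u : Fin d → ℤ // ‖u‖ ≤ (j : ℝ)} → ℝ) → ℝ, Measurable h ∧
      increment μ ε Y j = localField ε j h 0 := by
  have hs : StronglyMeasurable[sigmaBall ε j] (increment μ ε Y j) := by
    cases j with
    | zero => exact stronglyMeasurable_condExp
    | succ j =>
      exact stronglyMeasurable_condExp.sub
        (stronglyMeasurable_condExp.mono ((ballFiltration ε hm).mono (Nat.le_succ j)))
  rw [sigmaBall_eq_comap] at hs
  obtain ⟨h, hh, he⟩ := hs.exists_eq_measurable_comp
  refine ⟨h, hh.measurable, ?_⟩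
  rw [he]
  ext ω
  simp [localField, shiftFamily]

lemma ae_tendsto_sum_increment (hm : ∀ u, Measurable (ε u)) {F : ((Fin d → ℤ) → ℝ) → ℝ}
    (hF : Measurable F) (hint : Integrable (fun ω => F fun u => ε u ω) μ) :
    ∀ᵐ ω ∂μ, Filter.Tendsto (fun J => ∑ j ∈ Finset.range J,
      increment μ ε (fun ω => F fun u => ε u ω) j ω) Filter.atTop (nhds (F fun u => ε u ω)) := by
  have hFm : Measurable[⨆ n, ballFiltration ε hm n] fun ω => F fun u => ε u ω := by
    refine hF.comp (@measurable_pi_lambda _ _ _ (⨆ n, ballFiltration ε hm n) _ _ fun u => ?_)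
    have h1 : Measurable[sigmaBall ε ⌈‖u‖⌉₊] (ε u) :=
      (comap_measurable (ε u)).mono (le_iSup_of_le
        (f := fun v : {v : Fin d → ℤ // ‖v‖ ≤ (⌈‖u‖⌉₊ : ℝ)} =>
          MeasurableSpace.comap (ε v) inferInstance) ⟨u, Nat.le_ceil _⟩ le_rfl) le_rfl
    exact h1.mono (le_iSup (fun n => ballFiltration ε hm n) _) le_rfl
  filter_upwards [hint.tendsto_ae_condExp hFm.stronglyMeasurable] with ω hω
  rw [← Filter.tendsto_add_atTop_iff_nat 1]
  refine hω.congr fun J => ?_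
  rw [show (ballFiltration ε hm) J = sigmaBall ε J from rfl, ← sum_increment, Finset.sum_apply]

/-- If a field is the pointwise sum of a series of fields, its maximal function is at most the sum
of their maximal functions. -/
lemma maximalFunction_le_tsum {X : (Fin d → ℤ) → Ω → ℝ} {X' : ℕ → (Fin d → ℤ) → Ω → ℝ} {ω : Ω}
    (h : ∀ i, Filter.Tendsto (fun J => ∑ j ∈ Finset.range J, X' j i ω) Filter.atTop
      (nhds (X i ω))) :
    maximalFunction X ω ≤ ∑' j, maximalFunction (X' j) ω := by
  refine iSup_le fun n => ?_
  set D := Real.sqrt (vol n * LL (vol n)) with hD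
  have h0 : 0 ≤ D := Real.sqrt_nonneg _
  have h1 : Filter.Tendsto (fun J => ∑ j ∈ Finset.range J, partialSum (X' j) n ω) Filter.atTop
      (nhds (partialSum X n ω)) := by
    simp only [partialSum]
    simp_rw [Finset.sum_comm (s := Finset.range _)]
    exact tendsto_finsetSum _ fun i _ => h i
  have h2 := ENNReal.tendsto_ofReal ((h1.abs).div_const D)
  refine le_of_tendsto' h2 fun J => ?_
  refine (ENNReal.ofReal_le_ofReal
    (div_le_div_of_nonneg_right (Finset.abs_sum_le_sum_abs _ _) h0)).trans ?_
  rw [Finset.sum_div, ENNReal.ofReal_sum_of_nonneg fun j _ => by positivity]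
  exact (Finset.sum_le_sum fun j _ => le_iSup (fun n : Fin d → ℕ+ =>
    ENNReal.ofReal (|partialSum (X' j) n ω| / Real.sqrt (vol n * LL (vol n)))) n).trans
    (ENNReal.sum_le_tsum _)

lemma eLpNorm_maximalFunction_le {C : ℝ≥0∞} {p : ℝ} (hp : 1 ≤ p)
    (hC : ∀ Y : (Fin d → ℕ) → Ω → ℝ, (∀ i, Measurable (Y i)) → iIndepFun Y μ →
      (∀ i, IdentDistrib (Y i) (Y 0) μ μ) → ∫ ω, Y 0 ω ∂μ = 0 →
      eLpNorm (boxMax Y) (ENNReal.ofReal p) μ ≤ C * orliczNorm μ 2 ((d : ℝ) - 1) (Y 0))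
    (hm : ∀ u, Measurable (ε u)) (hi : iIndepFun ε μ)
    (hid : ∀ u, IdentDistrib (ε u) (ε 0) μ μ) {F : ((Fin d → ℤ) → ℝ) → ℝ} (hF : Measurable F)
    (hint : Integrable (fun ω => F fun u => ε u ω) μ) (hc : ∫ ω, F (fun u => ε u ω) ∂μ = 0) :
    eLpNorm (maximalFunction fun i ω => F (shiftFamily ε i ω)) (ENNReal.ofReal p) μ ≤
      ∑' j : ℕ, ENNReal.ofReal ((2 * Real.sqrt (2 * j + 1)) ^ d) *
        (C * orliczNorm μ 2 ((d : ℝ) - 1) (increment μ ε (fun ω => F fun u => ε u ω) j)) := by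
  set Y : Ω → ℝ := fun ω => F fun u => ε u ω with hY
  choose h hh he using fun j => exists_increment_eq (μ := μ) hm Y j
  have hlim : ∀ i, ∀ᵐ ω ∂μ, Filter.Tendsto
      (fun J => ∑ j ∈ Finset.range J, localField ε j (h j) i ω) Filter.atTop
      (nhds (F (shiftFamily ε i ω))) := by
    intro i
    have hG : ∀ j, Measurable fun e : (Fin d → ℤ) → ℝ =>
        h j fun u : {u : Fin d → ℤ // ‖u‖ ≤ (j : ℝ)} => e u.1 := fun j =>
      (hh j).comp (measurable_pi_lambda _ fun _ => measurable_pi_apply _)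
    -- Convergence is a measurable event for the family `ε`; shifted families have the same law, so
    -- almost sure convergence at the origin carries over to site `i`.
    have hset := measurableSet_tendsto_fun (l := Filter.atTop)
      (fun J => Finset.measurable_fun_sum (Finset.range J) fun j _ => hG j) hF
    refine (identDistrib_shiftFamily hi hid 0 i).ae_snd hset ?_
    filter_upwards [ae_tendsto_sum_increment hm hF hint] with ω hω
    have h0 : shiftFamily ε 0 ω = fun u => ε u ω := by ext u; simp [shiftFamily]
    rw [h0]
    refine hω.congr fun J => Finset.sum_congr rfl fun j _ => ?_
    rw [he j, localField, h0]
  have hae : ∀ᵐ ω ∂μ, maximalFunction (fun i ω => F (shiftFamily ε i ω)) ω ≤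
      ∑' j, maximalFunction (localField ε j (h j)) ω := by
    filter_upwards [ae_all_iff.2 hlim] with ω hω
    exact maximalFunction_le_tsum (X' := fun j => localField ε j (h j)) hω
  refine (eLpNorm_mono_enorm_ae (g := fun ω => ∑' j, maximalFunction (localField ε j (h j)) ω)
    (by simpa using hae)).trans ?_
  refine (eLpNorm_tsum_le hp fun j =>
    measurable_maximalFunction fun i => measurable_localField hm (hh j) i).trans ?_
  refine ENNReal.tsum_le_tsum fun j => ?_
  rw [he j]
  refine eLpNorm_maximalFunction_localField_le hp hC hm hi hid (hh j) ?_
  rw [← he j]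
  exact integral_increment hm hc j

end Increments

lemma two_mul_sqrt_pow_le (d j : ℕ) :
    (2 * Real.sqrt (2 * j + 1)) ^ d ≤ (2 * Real.sqrt 2) ^ d * ((j : ℝ) + 1) ^ ((d : ℝ) / 2) := by
  have h : ((j : ℝ) + 1) ^ ((d : ℝ) / 2) = Real.sqrt (j + 1) ^ d := by
    rw [Real.sqrt_eq_rpow, ← Real.rpow_natCast, ← Real.rpow_mul (by positivity)]
    congr 1; ring
  rw [h, ← mul_pow, mul_assoc, ← Real.sqrt_mul (by norm_num)]
  gcongr
  linarith

end RandomFieldLIL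

/-! ### The theorem for general fields -/

theorem mainTheorem1 (d : ℕ) (hd : 1 ≤ d) (p : ℝ) (hp1 : 1 < p) (hp2 : p < 2) :
    ∃ c : ℝ, 0 < c ∧
      ∀ (Ω : Type*) [MeasurableSpace Ω] (μ : Measure Ω) [IsProbabilityMeasure μ]
        (ε : (Fin d → ℤ) → Ω → ℝ) (f : ((Fin d → ℤ) → ℝ) → ℝ) (X : (Fin d → ℤ) → Ω → ℝ),
        (∀ u, Measurable (ε u)) →
        iIndepFun ε μ →
        (∀ u, IdentDistrib (ε u) (ε 0) μ μ) →
        Measurable f →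
        (∀ i ω, X i ω = f (fun j => ε (i - j) ω)) →
        (∀ i, Integrable (X i) μ) →
        (∀ i, ∫ ω, X i ω ∂μ = 0) →
        eLpNorm (RandomFieldLIL.maximalFunction X) (ENNReal.ofReal p) μ ≤
          ENNReal.ofReal c *
            ∑' j : ℕ, ENNReal.ofReal (((j : ℝ) + 1) ^ ((d : ℝ) / 2)) *
              RandomFieldLIL.orliczNorm μ 2 ((d : ℝ) - 1)
                (RandomFieldLIL.increment μ ε (X 0) j) := by
  obtain ⟨C, hC, hmax⟩ := RandomFieldLIL.exists_eLpNorm_boxMax_le hd hp1 hp2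
  refine ⟨(2 * Real.sqrt 2) ^ d * (C.toReal + 1), by positivity,
    fun Ω _ μ _ ε f X hm hi hid hf hX hint hc => ?_⟩
  -- The field evaluates `f` at `ε (i - j)` while `shiftFamily` uses `ε (i + u)`; `F` is `f`
  -- composed with the reflection. Balls are symmetric, so the increments are unaffected.
  set F : ((Fin d → ℤ) → ℝ) → ℝ := fun e => f fun j => e (-j) with hFdef
  have hF : Measurable F := hf.comp (measurable_pi_lambda _ fun j => measurable_pi_apply _)
  have hXi : X = fun i ω => F (RandomFieldLIL.shiftFamily ε i ω) := by
    ext i ω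
    simp [hX, hFdef, RandomFieldLIL.shiftFamily, sub_eq_add_neg]
  have hX0 : X 0 = fun ω => F fun u => ε u ω := by
    ext ω
    simp [hX, hFdef]
  have hint0 := hint 0
  have hc0 := hc 0
  rw [hX0] at hint0 ⊢
  simp only [hX0] at hc0
  rw [hXi]
  refine (RandomFieldLIL.eLpNorm_maximalFunction_le hp1.le (hmax μ) hm hi hid hF hint0 hc0).trans ?_
  rw [← ENNReal.tsum_mul_left]
  refine ENNReal.tsum_le_tsum fun j => ?_
  rw [← mul_assoc, ← mul_assoc]
  refine mul_le_mul_left ?_ _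
  rw [← ENNReal.ofReal_mul (by positivity)]
  calc _ ≤ ENNReal.ofReal ((2 * Real.sqrt 2) ^ d * ((j : ℝ) + 1) ^ ((d : ℝ) / 2)) *
        ENNReal.ofReal (C.toReal + 1) := by
        gcongr
        · exact RandomFieldLIL.two_mul_sqrt_pow_le d j
        · rw [ENNReal.le_ofReal_iff_toReal_le hC (by positivity)]
          linarith
    _ = _ := by
        rw [← ENNReal.ofReal_mul (by positivity)]
        congr 1
        ring
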